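/- Let $(\mathbb X,\mathcal X)$ be a measurable space, and let $\mathbf N_\sigma$ be the space of all $\sigma$-finite measures $\chi$ on $\mathbb X$ with $\chi(B)\in\{0,1,2,\dots\}\cup\{\infty\}$ for all $B\in\mathcal X$, equipped with the smallest $\sigma$-field making all maps $\chi\mapsto\chi(B)$, $B\in\mathcal X$, measurable. Let $\mu$ be a $\sigma$-finite measure on $\mathbb X$ and let $\eta$ be a Poisson process on $\mathbb X$ with intensity measure $\mu$, that is, a random element of $\mathbf N_\sigma$, defined on a probability space $(\Omega,\mathcal A,\mathbb P)$, such that $\eta(B_1),\dots,\eta(B_m)$ are independent for all pairwise disjoint $B_1,\dots,B_m\in\mathcal X$, $m\in\mathbb N$, and $\mathbb P(\eta(B)=k)=\frac{\mu(B)^k}{k!}e^{-\mu(B)}$ for all $B\in\mathcal X$ and all integers $k\ge 0$ (the right-hand side being read as $0$ if $\mu(B)=\infty$). Let $\mathbb P_\eta$ denote the distribution of $\eta$. For $f:\mathbf N_\sigma\to\mathbb R$ and $x\in\mathbb X$ let $D_xf(\chi):=f(\chi+\delta_x)-f(\chi)$; put $D^0f:=f$ and, for $n\ge 1$, $D^n_{x_1,\dots,x_n}f:=D_{x_1}D^{n-1}_{x_2,\dots,x_n}f$.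 Let $T_nf(x_1,\dots,x_n):=\mathbb E\,D^n_{x_1,\dots,x_n}f(\eta)$, and let $\langle u,v\rangle_n:=\int uv\,d\mu^n$ be the scalar product of $L^2(\mu^n)$. Let $f,g\in L^2(\mathbb P_\eta)$. Then, for every $n\ge 0$, the expectations defining $T_nf$ and $T_ng$ exist $\mu^n$-almost everywhere, $T_nf,T_ng\in L^2(\mu^n)$, and $$\mathbb E f(\eta)g(\eta)=(\mathbb E f(\eta))(\mathbb E g(\eta))+\sum_{n=1}^\infty\frac1{n!}\langle T_nf,T_ng\rangle_n,$$ where the series converges absolutely. -/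

import Mathlib

open MeasureTheory ProbabilityTheory
open scoped ENNReal Nat

noncomputable section

/-- The space of all `σ`-finite measures `χ` on `X` with `χ B ∈ {0, 1, 2, …} ∪ {∞}` for every
measurable set `B`. -/
def CountingMeasures (X : Type*) [MeasurableSpace X] : Type _ :=
  {χ : Measure X // SigmaFinite χ ∧ ∀ B, MeasurableSet B → ∃ k : ℕ∞, χ B = (k : ℝ≥0∞)}

namespace CountingMeasures

variable {X : Type*} [MeasurableSpace X]

/-- The smallest `σ`-field on the space of counting measures making all evaluations
`χ ↦ χ B`, with `B` measurable, measurable. -/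
instance : MeasurableSpace (CountingMeasures X) :=
  ⨆ (B : Set X) (_ : MeasurableSet B),
    MeasurableSpace.comap (fun χ : CountingMeasures X => χ.1 B) (borel ℝ≥0∞)

/-- The measure `χ + δ_x`. -/
def addDirac (χ : CountingMeasures X) (x : X) : CountingMeasures X :=
  ⟨χ.1 + Measure.dirac x, by
    obtain ⟨χ, hσ, hχ⟩ := χ
    refine ⟨inferInstance, fun B hB => ?_⟩
    obtain ⟨k, hk⟩ := hχ B hB
    by_cases hx : x ∈ B
    · exact ⟨k + 1, by simp [hk, Measure.dirac_apply' x hB, hx]⟩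
    · exact ⟨k, by simp [hk, Measure.dirac_apply' x hB, hx]⟩⟩

/-- The difference operator `D_x f (χ) = f (χ + δ_x) - f χ`. -/
def diffOp (x : X) (f : CountingMeasures X → ℝ) : CountingMeasures X → ℝ :=
  fun χ => f (χ.addDirac x) - f χ

/-- The iterated difference operator: `D^0 f = f` and
`D^{n+1}_{x_0, …, x_n} f = D_{x_0} (D^n_{x_1, …, x_n} f)`. -/
def iterDiffOp (f : CountingMeasures X → ℝ) : (n : ℕ) → (Fin n → X) → CountingMeasures X → ℝ
  | 0, _ => f
  | n + 1, x => diffOp (x 0) (iterDiffOp f n (fun i => x i.succ))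

end CountingMeasures

/-- `η` is a Poisson process on `X` with intensity measure `μ`, defined on the measure space
`(Ω, P)`: a random element of the space of counting measures that has independent increments
and for which `η B` has the Poisson distribution with parameter `μ B`. If `μ B = ∞`, the
probability of `η B = k` is zero for every natural number `k`. -/
structure IsPoissonProcess {Ω X : Type*} [MeasurableSpace Ω] [MeasurableSpace X]
    (η : Ω → CountingMeasures X) (μ : Measure X) (P : Measure Ω) : Prop where
  measurable : Measurable η
  indep : ∀ (m : ℕ) (B : Fin m → Set X), (∀ i, MeasurableSet (B i)) →
    Pairwise (fun i j => Disjoint (B i) (B j)) → iIndepFun (fun i ω => (η ω).1 (B i)) P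
  law : ∀ B : Set X, MeasurableSet B → ∀ k : ℕ,
    P {ω | (η ω).1 B = (k : ℝ≥0∞)} =
      if μ B = ∞ then 0
      else ENNReal.ofReal ((μ B).toReal ^ k / k ! * Real.exp (-(μ B).toReal))

/-- `T_n f (x_1, …, x_n) = E D^n_{x_1, …, x_n} f (η)`. -/
def expectedDiff {Ω X : Type*} [MeasurableSpace Ω] [MeasurableSpace X]
    (η : Ω → CountingMeasures X) (P : Measure Ω) (f : CountingMeasures X → ℝ)
    (n : ℕ) (x : Fin n → X) : ℝ :=
  ∫ ω, CountingMeasures.iterDiffOp f n x (η ω) ∂P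

end

/-! The exponential functionals `lap u`, with `u` simple and supported on a set of finite
`μ`-measure, satisfy the identity by direct computation. Adding `δ_x` multiplies `lap u` by `e^{-u
x}`, so its `n`-th difference is `∏ (e^{-u (x i)} - 1)` times itself (`iterDiffOp_lap`), and
independence over the fibres of `u` gives the mean `exp (-∫ (1 - e^{-u}) dμ)`
(`IsPoissonProcess.integral_lap`). The chaos series of `lap u` and `lap v` is then an exponential
series, with sum `E lap (u + v)` (`inner_lapPair`).

These functionals are total in `L²(P_η)`, because a finite measure on the space of counting measures
is determined by its integrals of them (`ext_of_lap`, `eq_zero_of_inner_lap`). Hence `lap u ↦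
((n!)^{-1/2} T_n (lap u))_n` extends to an isometry from `L²(P_η)` into a Fock space, constructed as
the closure of its graph (`exists_mem_closedGraph`).

It remains to see that the extension is still given by `T_n`. The Mecke equation
(`lintegral_addDirac`), obtained by differentiating the Laplace functional, bounds `∫_{B^n} E |D^n
f| dμ^n` by a finite constant times `‖f‖₂` whenever `μ B < ∞` (`lintegral_iterDiffOp_le_eLpNorm`).
So the relation "the `n`-th component is `(n!)^{-1/2} T_n f` almost everywhere" is closed
(`isClosed_fockGraph`) and passes from exponentials to every `f`. Preservation of inner products is
then the theorem, the term `n = 0` being the product of the means. -/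

open scoped NNReal Topology

/-! ### The exponential on `[0, ∞]`. -/

/-- The function `a ↦ e^{-a}` on `[0, ∞]`, with value `0` at `∞`. -/
noncomputable def expNeg (a : ℝ≥0∞) : ℝ := if a = ∞ then 0 else Real.exp (-a.toReal)

@[simp] lemma expNeg_top : expNeg ∞ = 0 := by simp [expNeg]

@[simp] lemma expNeg_zero : expNeg 0 = 1 := by simp [expNeg]

lemma expNeg_coe (a : ℝ≥0) : expNeg a = Real.exp (-a) := by simp [expNeg]

lemma expNeg_add (a b : ℝ≥0∞) : expNeg (a + b) = expNeg a * expNeg b := by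
  induction a with
  | top => simp
  | coe a =>
    induction b with
    | top => simp
    | coe b =>
      rw [← ENNReal.coe_add, expNeg_coe, expNeg_coe, expNeg_coe, ← Real.exp_add]
      congr 1
      push_cast
      ring

lemma expNeg_sum {ι : Type*} (s : Finset ι) (a : ι → ℝ≥0∞) :
    expNeg (∑ i ∈ s, a i) = ∏ i ∈ s, expNeg (a i) := by
  classical
  induction s using Finset.induction_on with
  | empty => simp
  | insert i s hi ih => rw [Finset.sum_insert hi, Finset.prod_insert hi, expNeg_add, ih]

lemma expNeg_nonneg (a : ℝ≥0∞) : 0 ≤ expNeg a := by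
  unfold expNeg
  split_ifs
  · rfl
  · positivity

lemma expNeg_le_one (a : ℝ≥0∞) : expNeg a ≤ 1 := by
  unfold expNeg
  split_ifs
  · exact zero_le_one
  · simp

lemma measurable_expNeg : Measurable expNeg :=
  Measurable.ite (measurableSet_singleton _) measurable_const (by fun_prop)

/-- A left inverse of `expNeg`. -/
noncomputable def negLog (y : ℝ) : ℝ≥0∞ := if y = 0 then ∞ else ENNReal.ofReal (-Real.log y)

lemma measurable_negLog : Measurable negLog :=
  Measurable.ite (measurableSet_singleton _) measurable_const (by fun_prop)

lemma negLog_expNeg (a : ℝ≥0∞) : negLog (expNeg a) = a := by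
  induction a with
  | top => simp [negLog]
  | coe a => simp [negLog, expNeg_coe, (Real.exp_pos _).ne']

/-! ### Measurability and exponential functionals. -/

namespace CountingMeasures

variable {X : Type*} [MeasurableSpace X]

lemma measurable_eval {B : Set X} (hB : MeasurableSet B) :
    Measurable (fun χ : CountingMeasures X => χ.1 B) := by
  rw [measurable_iff_comap_le]
  exact le_iSup₂_of_le B hB le_rfl

lemma measurable_of_eval {α : Type*} [MeasurableSpace α] {F : α → CountingMeasures X}
    (h : ∀ B, MeasurableSet B → Measurable (fun a => (F a).1 B)) : Measurable F := by
  rw [measurable_iff_comap_le]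
  simp only [instMeasurableSpace, MeasurableSpace.comap_iSup, iSup_le_iff]
  intro B hB
  rw [MeasurableSpace.comap_comp, ← measurable_iff_comap_le]
  exact h B hB

lemma addDirac_apply (χ : CountingMeasures X) (x : X) {B : Set X} (hB : MeasurableSet B) :
    (χ.addDirac x).1 B = χ.1 B + B.indicator 1 x := by
  simp [addDirac, Measure.dirac_apply' x hB]

lemma measurable_addDirac :
    Measurable (fun p : X × CountingMeasures X => p.2.addDirac p.1) := by
  refine measurable_of_eval fun B hB => ?_
  simp only [addDirac_apply _ _ hB]
  exact ((measurable_eval hB).comp measurable_snd).add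
    ((measurable_one.indicator hB).comp measurable_fst)

lemma measurable_iterDiffOp {f : CountingMeasures X → ℝ} (hf : Measurable f) (n : ℕ) :
    Measurable (fun p : (Fin n → X) × CountingMeasures X => iterDiffOp f n p.1 p.2) := by
  induction n with
  | zero => exact hf.comp measurable_snd
  | succ n ih =>
    have ht : Measurable (fun p : (Fin (n + 1) → X) × CountingMeasures X =>
        (fun i : Fin n => p.1 i.succ)) := by fun_prop
    have ha : Measurable (fun p : (Fin (n + 1) → X) × CountingMeasures X =>
        p.2.addDirac (p.1 0)) :=
      measurable_addDirac.comp
        (((measurable_pi_apply 0).comp measurable_fst).prodMk measurable_snd)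
    exact (ih.comp (ht.prodMk ha)).sub (ih.comp (ht.prodMk measurable_snd))

lemma iterDiffOp_add (f g : CountingMeasures X → ℝ) (n : ℕ) (x : Fin n → X) :
    iterDiffOp (f + g) n x = iterDiffOp f n x + iterDiffOp g n x := by
  induction n with
  | zero => rfl
  | succ n ih =>
    funext χ
    simp only [iterDiffOp, diffOp, ih, Pi.add_apply]
    ring

lemma iterDiffOp_smul (c : ℝ) (f : CountingMeasures X → ℝ) (n : ℕ) (x : Fin n → X) :
    iterDiffOp (c • f) n x = c • iterDiffOp f n x := by
  induction n with
  | zero => rfl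
  | succ n ih =>
    funext χ
    simp only [iterDiffOp, diffOp, ih, Pi.smul_apply, smul_eq_mul]
    ring

/-- The exponential functional `χ ↦ exp (-∫ u dχ)`. -/
noncomputable def lap (u : SimpleFunc X ℝ≥0) (χ : CountingMeasures X) : ℝ :=
  expNeg (∫⁻ x, u x ∂χ.1)

lemma lintegral_eq_sum (u : SimpleFunc X ℝ≥0) (χ : Measure X) :
    ∫⁻ x, u x ∂χ = ∑ c ∈ u.range, (c : ℝ≥0∞) * χ (u ⁻¹' {c}) := by
  rw [← SimpleFunc.map_lintegral, ← SimpleFunc.lintegral_eq_lintegral]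
  rfl

/-- The fibres of `u` are disjoint, so under a Poisson process the factors are independent. -/
lemma lap_eq_prod (u : SimpleFunc X ℝ≥0) (χ : CountingMeasures X) :
    lap u χ = ∏ c ∈ u.range, expNeg ((c : ℝ≥0∞) * χ.1 (u ⁻¹' {c})) := by
  rw [lap, lintegral_eq_sum, expNeg_sum]

lemma measurable_lap (u : SimpleFunc X ℝ≥0) : Measurable (lap u) := by
  refine measurable_expNeg.comp ?_
  simp only [lintegral_eq_sum]
  exact Finset.measurable_sum _ fun c _ =>
    (measurable_eval (u.measurableSet_fiber c)).const_mul _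

lemma lap_nonneg (u : SimpleFunc X ℝ≥0) (χ : CountingMeasures X) : 0 ≤ lap u χ :=
  expNeg_nonneg _

lemma norm_lap_le (u : SimpleFunc X ℝ≥0) (χ : CountingMeasures X) : ‖lap u χ‖ ≤ 1 := by
  rw [Real.norm_of_nonneg (lap_nonneg u χ)]
  exact expNeg_le_one _

lemma lap_add (u v : SimpleFunc X ℝ≥0) (χ : CountingMeasures X) :
    lap (u + v) χ = lap u χ * lap v χ := by
  rw [lap, lap, lap, ← expNeg_add, ← lintegral_add_left (by fun_prop)]
  simp

lemma lap_zero (χ : CountingMeasures X) : lap (0 : SimpleFunc X ℝ≥0) χ = 1 := by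
  simp [lap]

lemma lap_addDirac (u : SimpleFunc X ℝ≥0) (χ : CountingMeasures X) (x : X) :
    lap u (χ.addDirac x) = Real.exp (-u x) * lap u χ := by
  rw [lap, lap, ← expNeg_coe, ← expNeg_add, add_comm]
  congr 1
  simp only [addDirac]
  rw [lintegral_add_measure, lintegral_dirac' _ (by fun_prop)]

/-- The function `t` times the indicator of `B`. -/
noncomputable def stepFun {B : Set X} (hB : MeasurableSet B) (t : ℝ≥0) : SimpleFunc X ℝ≥0 :=
  SimpleFunc.piecewise B hB (SimpleFunc.const X t) 0

lemma stepFun_apply {B : Set X} (hB : MeasurableSet B) (t : ℝ≥0) (x : X) :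
    stepFun hB t x = B.indicator (fun _ => t) x := by
  classical
  simp only [stepFun, SimpleFunc.coe_piecewise, Set.indicator, Set.piecewise]
  rfl

lemma lap_stepFun {B : Set X} (hB : MeasurableSet B) (t : ℝ≥0) (χ : CountingMeasures X) :
    lap (stepFun hB t) χ = expNeg (t * χ.1 B) := by
  have : ∀ x, (stepFun hB t x : ℝ≥0∞) = B.indicator (fun _ => (t : ℝ≥0∞)) x := by
    intro x
    rw [stepFun_apply]
    by_cases hx : x ∈ B <;> simp [hx]
  rw [lap]
  simp only [this]
  rw [lintegral_indicator_const hB]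

/-- Exponentials are eigenfunctions of every `D_x`, with eigenvalue `e^{-u x} - 1`. -/
lemma iterDiffOp_lap (u : SimpleFunc X ℝ≥0) (n : ℕ) (x : Fin n → X) (χ : CountingMeasures X) :
    iterDiffOp (lap u) n x χ = (∏ i, (Real.exp (-u (x i)) - 1)) * lap u χ := by
  induction n generalizing χ with
  | zero => simp [iterDiffOp]
  | succ n ih =>
    simp only [iterDiffOp, diffOp, ih, lap_addDirac, Fin.prod_univ_succ]
    ring

end CountingMeasures

/-! ### Uniqueness of measures with given Laplace functional. -/

open BoundedContinuousFunction in
/-- Finite measures on a finite-dimensional cube are determined by their mixed moments. -/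
theorem ext_of_monomials {J : Type*} [Fintype J] {m m' : Measure (J → Set.Icc (0 : ℝ) 1)}
    [IsFiniteMeasure m] [IsFiniteMeasure m']
    (h : ∀ k : J → ℕ, ∫ y, ∏ j, (y j : ℝ) ^ k j ∂m = ∫ y, ∏ j, (y j : ℝ) ^ k j ∂m') :
    m = m' := by
  classical
  let e : J → ((J → Set.Icc (0 : ℝ) 1) →ᵇ ℝ) := fun j =>
    BoundedContinuousFunction.mkOfCompact ⟨fun y => (y j : ℝ), by fun_prop⟩
  let A : StarSubalgebra ℝ ((J → Set.Icc (0 : ℝ) 1) →ᵇ ℝ) :=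
    { Algebra.adjoin ℝ (Set.range e) with
      star_mem' := fun {a} ha => by
        have : star a = a := by ext; simp
        rwa [this] }
  refine ext_of_forall_mem_subalgebra_integral_eq_of_pseudoEMetric_complete_countable
    (A := A) ?_ ?_
  · intro y z hyz
    obtain ⟨j, hj⟩ := Function.ne_iff.1 hyz
    refine ⟨fun y => (y j : ℝ), ⟨toContinuousMapStarₐ ℝ (e j), ⟨e j, ?_, rfl⟩, rfl⟩, ?_⟩
    · exact Algebra.subset_adjoin ⟨j, rfl⟩
    · exact fun hc => hj (Subtype.ext hc)
  · intro g hg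
    -- The algebra is the linear span of the products of coordinates, so testing on monomials
    -- suffices.
    have hg' : g ∈ Submodule.span ℝ (Submonoid.closure (Set.range e) : Set _) := by
      rw [← Algebra.adjoin_eq_span]
      exact hg
    clear hg
    induction hg' using Submodule.span_induction with
    | mem g hg =>
      have : ∃ k : J → ℕ, ∀ y, g y = ∏ j, (y j : ℝ) ^ k j := by
        induction hg using Submonoid.closure_induction with
        | mem g hg =>
          obtain ⟨j, rfl⟩ := hg
          refine ⟨Pi.single j 1, fun y => ?_⟩
          rw [Finset.prod_eq_single j]
          · simp [e]
          · intro i _ hi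
            simp [hi]
          · simp
        | one => exact ⟨0, fun y => by simp⟩
        | mul g g' _ _ hg hg' =>
          obtain ⟨k, hk⟩ := hg
          obtain ⟨k', hk'⟩ := hg'
          exact ⟨k + k', fun y => by simp [hk, hk', pow_add, Finset.prod_mul_distrib]⟩
      obtain ⟨k, hk⟩ := this
      simp only [hk, h]
    | zero => simp
    | add g g' hg hg' ih ih' =>
      simp only [BoundedContinuousFunction.coe_add, Pi.add_apply]
      rw [integral_add (g.integrable m) (g'.integrable m),
        integral_add (g.integrable m') (g'.integrable m'), ih, ih']
    | smul c g hg ih =>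
      simp only [BoundedContinuousFunction.coe_smul, integral_smul, ih]

namespace CountingMeasures

variable {X : Type*} [MeasurableSpace X]

/-- The functional `χ ↦ (e^{-χ B})_B`, where `B` ranges over the sets of finite measure. -/
noncomputable def expEval (μ : Measure X) (χ : CountingMeasures X)
    (B : {B : Set X // MeasurableSet B ∧ μ B < ∞}) : Set.Icc (0 : ℝ) 1 :=
  ⟨expNeg (χ.1 B.1), expNeg_nonneg _, expNeg_le_one _⟩

lemma measurable_expEval (μ : Measure X) : Measurable (expEval μ) :=
  measurable_pi_lambda _ fun B =>
    (measurable_expNeg.comp (measurable_eval B.2.1)).subtype_mk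

/-- Coordinates with `μ B < ∞` suffice: for general `B`, exhaust by spanning sets, use continuity
from below, and recover each value from its exponential by `negLog`. -/
lemma le_comap_expEval (μ : Measure X) [SigmaFinite μ] :
    (inferInstance : MeasurableSpace (CountingMeasures X)) ≤
      MeasurableSpace.comap (expEval μ) MeasurableSpace.pi := by
  refine iSup₂_le fun B hB => ?_
  rw [← measurable_iff_comap_le]
  have hmeas : ∀ k, MeasurableSet (B ∩ spanningSets μ k) := fun k =>
    hB.inter (measurableSet_spanningSets μ k)
  have hfin : ∀ k, μ (B ∩ spanningSets μ k) < ∞ := fun k =>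
    (measure_mono Set.inter_subset_right).trans_lt (measure_spanningSets_lt_top μ k)
  have heq : (fun χ : CountingMeasures X => χ.1 B) = fun χ => ⨆ k,
      negLog (expEval μ χ ⟨B ∩ spanningSets μ k, hmeas k, hfin k⟩ : ℝ) := by
    funext χ
    simp only [expEval, negLog_expNeg]
    rw [← Monotone.measure_iUnion, ← Set.inter_iUnion, iUnion_spanningSets, Set.inter_univ]
    exact fun i j hij => Set.inter_subset_inter_right _ (monotone_spanningSets μ hij)
  rw [heq]
  -- From here measurability refers to the pulled-back `σ`-field.
  let _ : MeasurableSpace (CountingMeasures X) :=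
    MeasurableSpace.comap (expEval μ) MeasurableSpace.pi
  refine Measurable.iSup fun k => measurable_negLog.comp (measurable_subtype_coe.comp ?_)
  exact (measurable_pi_apply _).comp (comap_measurable (expEval μ))

/-- Finite measures on the space of counting measures are determined by the integrals of
exponential functionals. -/
theorem ext_of_lap (μ : Measure X) [SigmaFinite μ] {m m' : Measure (CountingMeasures X)}
    [IsFiniteMeasure m] [IsFiniteMeasure m']
    (h : ∀ u : SimpleFunc X ℝ≥0, μ (Function.support u) < ∞ →
      ∫ χ, lap u χ ∂m = ∫ χ, lap u χ ∂m') : m = m' := by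
  have hΦ := measurable_expEval μ
  have hmap : m.map (expEval μ) = m'.map (expEval μ) := by
    -- A finite measure on the infinite product is determined by its finite-dimensional marginals,
    -- and these by their moments.
    refine IsProjectiveLimit.unique
      (P := fun J => (m.map (expEval μ)).map J.restrict) (fun J => rfl) (fun J => ?_)
    refine ext_of_monomials fun k => ?_
    have hr := Finset.measurable_restrict
      (X := fun _ : {B : Set X // MeasurableSet B ∧ μ B < ∞} => Set.Icc (0 : ℝ) 1) J
    have hc : Continuous fun y : J → Set.Icc (0 : ℝ) 1 => ∏ j, (y j : ℝ) ^ k j := by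
      fun_prop
    dsimp only
    rw [Measure.map_map hr hΦ, Measure.map_map hr hΦ,
      integral_map (hr.comp hΦ).aemeasurable hc.aestronglyMeasurable,
      integral_map (hr.comp hΦ).aemeasurable hc.aestronglyMeasurable]
    -- The monomial `∏ (e^{-χ B_j})^{k_j}` is the exponential functional of `∑ k_j 1_{B_j}`.
    let u : SimpleFunc X ℝ≥0 := ∑ j : J, stepFun j.1.2.1 (k j)
    have hu : ∀ χ, lap u χ = ∏ j : J, (expEval μ χ j : ℝ) ^ k j := by
      intro χ
      have : ∀ s : Finset J, lap (∑ j ∈ s, stepFun j.1.2.1 (k j)) χ =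
          ∏ j ∈ s, (expEval μ χ j : ℝ) ^ k j := by
        classical
        intro s
        induction s using Finset.induction_on with
        | empty => simp [lap_zero]
        | insert j s hj ih =>
          rw [Finset.sum_insert hj, Finset.prod_insert hj, lap_add, ih, lap_stepFun]
          congr 1
          have := expNeg_sum (Finset.range (k j)) (fun _ => χ.1 j.1.1)
          simpa [expEval] using this
      exact this _
    have hsupp : μ (Function.support u) < ∞ := by
      refine (measure_mono (t := ⋃ j : J, j.1.1) ?_).trans_lt
        ((measure_iUnion_fintype_le _ _).trans_lt (ENNReal.sum_lt_top.2 fun j _ => j.1.2.2))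
      intro x hx
      by_contra hc
      simp only [Set.mem_iUnion, not_exists] at hc
      apply hx
      have : ∀ s : Finset J, (∑ j ∈ s, stepFun j.1.2.1 (k j : ℝ≥0)) x = 0 := by
        classical
        intro s
        induction s using Finset.induction_on with
        | empty => simp
        | insert j s hj ih =>
          rw [Finset.sum_insert hj, SimpleFunc.add_apply, ih, stepFun_apply]
          simp [hc j]
      exact this _
    have := (h u hsupp).symm
    simp only [hu] at this
    exact this
  ext s hs
  obtain ⟨t, ht, rfl⟩ := le_comap_expEval μ s hs
  rw [← Measure.map_apply hΦ ht, hmap, Measure.map_apply hΦ ht]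

/-! ### The Laplace functional of a Poisson process. -/

/-- The function `x ↦ 1 - e^{-u x}`. -/
noncomputable def oneSubExp (u : SimpleFunc X ℝ≥0) (x : X) : ℝ := 1 - Real.exp (-u x)

lemma measurable_oneSubExp (u : SimpleFunc X ℝ≥0) : Measurable (oneSubExp u) := by
  unfold oneSubExp
  fun_prop

lemma oneSubExp_nonneg (u : SimpleFunc X ℝ≥0) (x : X) : 0 ≤ oneSubExp u x := by
  simp [oneSubExp]

lemma oneSubExp_le_one (u : SimpleFunc X ℝ≥0) (x : X) : oneSubExp u x ≤ 1 := by
  simp only [oneSubExp]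
  linarith [Real.exp_pos (-(u x : ℝ))]

lemma support_oneSubExp_subset (u : SimpleFunc X ℝ≥0) :
    Function.support (oneSubExp u) ⊆ Function.support u := by
  intro x hx hux
  apply hx
  have : u x = 0 := hux
  simp [oneSubExp, this]

lemma integrable_oneSubExp {μ : Measure X} {u : SimpleFunc X ℝ≥0}
    (hu : μ (Function.support u) < ∞) : Integrable (oneSubExp u) μ := by
  rw [← integrableOn_iff_integrable_of_support_subset (support_oneSubExp_subset u)]
  refine Measure.integrableOn_of_bounded (M := 1) hu.ne
    (measurable_oneSubExp u).aestronglyMeasurable (Filter.Eventually.of_forall fun x => ?_)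
  rw [Real.norm_of_nonneg (oneSubExp_nonneg u x)]
  exact oneSubExp_le_one u x

lemma measure_fiber_lt_top {μ : Measure X} {u : SimpleFunc X ℝ≥0}
    (hu : μ (Function.support u) < ∞) {c : ℝ≥0} (hc : c ≠ 0) : μ (u ⁻¹' {c}) < ∞ := by
  refine (measure_mono fun x hx => ?_).trans_lt hu
  have : u x = c := hx
  simpa [this] using hc

lemma integral_oneSubExp {μ : Measure X} {u : SimpleFunc X ℝ≥0}
    (hu : μ (Function.support u) < ∞) :
    ∫ x, oneSubExp u x ∂μ =
      ∑ c ∈ u.range, (1 - Real.exp (-c)) * μ.real (u ⁻¹' {c}) := by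
  have h1 : ∀ x, oneSubExp u x =
      ∑ c ∈ u.range, (u ⁻¹' {c}).indicator (fun _ => 1 - Real.exp (-(c : ℝ))) x := by
    intro x
    rw [Finset.sum_eq_single_of_mem (u x) (u.mem_range_self x)]
    · simp [oneSubExp]
    · intro c _ hc
      simp [hc.symm]
  simp only [h1]
  rw [integral_finsetSum]
  · refine Finset.sum_congr rfl fun c _ => ?_
    rw [integral_indicator_const _ (u.measurableSet_fiber c), smul_eq_mul, mul_comm]
  · intro c _
    -- The fibre over `0` may have infinite measure, but its coefficient vanishes.
    by_cases hc : c = 0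
    · simp [hc]
    · exact (integrable_indicator_iff (u.measurableSet_fiber c)).2
        (integrableOn_const (measure_fiber_lt_top hu hc).ne)

end CountingMeasures

namespace IsPoissonProcess

open CountingMeasures

variable {Ω X : Type*} [MeasurableSpace Ω] [MeasurableSpace X]

lemma integral_expNeg {P : Measure Ω} [IsProbabilityMeasure P] {μ : Measure X}
    {η : Ω → CountingMeasures X} (hη : IsPoissonProcess η μ P) {C : Set X}
    (hC : MeasurableSet C) (hμC : μ C < ∞) (c : ℝ≥0) :
    ∫ ω, expNeg (c * (η ω).1 C) ∂P = Real.exp (-((1 - Real.exp (-c)) * μ.real C)) := by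
  set a := μ.real C with ha
  have hmK : Measurable fun ω => (η ω).1 C := (measurable_eval hC).comp hη.measurable
  let s : ℕ → Set Ω := fun k => {ω | (η ω).1 C = (k : ℝ≥0∞)}
  have hs : ∀ k, MeasurableSet (s k) := fun k => hmK (measurableSet_singleton _)
  have hd : Pairwise (Function.onFun Disjoint s) := by
    intro i j hij
    refine Set.disjoint_left.2 fun ω hi hj => hij ?_
    have : (i : ℝ≥0∞) = j := (Eq.symm hi).trans hj
    exact_mod_cast this
  have hP : ∀ k, P.real (s k) = a ^ k / k ! * Real.exp (-a) := by
    intro k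
    rw [measureReal_def, hη.law C hC k, if_neg hμC.ne, ENNReal.toReal_ofReal]
    · rfl
    · positivity
  have hexp : ∀ t : ℝ, HasSum (fun k : ℕ => t ^ k / k !) (Real.exp t) := fun t => by
    rw [Real.exp_eq_exp_ℝ]
    exact NormedSpace.expSeries_div_hasSum_exp t
  have hi : ∀ F : Ω → ℝ, Integrable F P →
      HasSum (fun k => ∫ ω in s k, F ω ∂P) (∫ ω in ⋃ k, s k, F ω ∂P) :=
    fun F hF => hasSum_integral_iUnion hs hd hF.integrableOn
  -- The law prescribes only the probabilities of finite values; these sum to `1`, so the value `∞`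
  -- is negligible.
  have huniv : (⋃ k, s k) =ᵐ[P] Set.univ := by
    rw [ae_eq_univ, prob_compl_eq_zero_iff (MeasurableSet.iUnion hs)]
    have h1 := hi (fun _ => 1) (integrable_const 1)
    simp only [integral_const, smul_eq_mul, mul_one, measureReal_restrict_apply_univ, hP] at h1
    have h2 := h1.unique ((hexp a).mul_right (Real.exp (-a)))
    rw [← Real.exp_add, add_neg_cancel, Real.exp_zero, measureReal_def] at h2
    exact (ENNReal.toReal_eq_one_iff _).1 h2
  have hF : Integrable (fun ω => expNeg (c * (η ω).1 C)) P := by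
    refine Integrable.of_bound
      (measurable_expNeg.comp (hmK.const_mul _)).aestronglyMeasurable 1
      (Filter.Eventually.of_forall fun ω => ?_)
    rw [Real.norm_of_nonneg (expNeg_nonneg _)]
    exact expNeg_le_one _
  have h1 := hi _ hF
  rw [setIntegral_congr_set huniv, setIntegral_univ] at h1
  have h2 : ∀ k, ∫ ω in s k, expNeg (c * (η ω).1 C) ∂P =
      (Real.exp (-c) * a) ^ k / k ! * Real.exp (-a) := by
    intro k
    have : ∀ ω ∈ s k, expNeg (c * (η ω).1 C) = Real.exp (-c) ^ k := by
      intro ω hω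
      have hω : (η ω).1 C = (k : ℝ≥0∞) := hω
      rw [hω, ← Real.exp_nat_mul]
      have := expNeg_coe (c * k)
      push_cast at this
      rw [this]
      congr 1
      ring
    rw [setIntegral_congr_fun (hs k) this, setIntegral_const, hP, smul_eq_mul, mul_pow]
    ring
  simp only [h2] at h1
  rw [h1.unique ((hexp _).mul_right (Real.exp (-a))), ← Real.exp_add]
  congr 1
  ring

/-- The Laplace functional of a Poisson process. -/
theorem integral_lap {P : Measure Ω} [IsProbabilityMeasure P] {μ : Measure X}
    {η : Ω → CountingMeasures X} (hη : IsPoissonProcess η μ P) (u : SimpleFunc X ℝ≥0)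
    (hu : μ (Function.support u) < ∞) :
    ∫ χ, lap u χ ∂(P.map η) = Real.exp (-∫ x, oneSubExp u x ∂μ) := by
  rw [integral_map hη.measurable.aemeasurable (measurable_lap u).aestronglyMeasurable]
  let e := u.range.equivFin.symm
  have hB : ∀ c, MeasurableSet (u ⁻¹' {c}) := u.measurableSet_fiber
  have hind := hη.indep u.range.card (fun i => u ⁻¹' {(e i : ℝ≥0)}) (fun i => hB _) (by
    intro i j hij
    refine Set.disjoint_left.2 fun x hi hj => hij ?_
    have hi : u x = e i := hi
    have hj : u x = e j := hj
    exact e.injective (Subtype.ext (hi.symm.trans hj)))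
  have hind' := hind.comp (fun i a => expNeg ((e i : ℝ≥0) * a))
    (fun i => measurable_expNeg.comp (measurable_id.const_mul _))
  have hprod := hind'.integral_fun_prod_eq_prod_integral (fun i =>
    (measurable_expNeg.comp (((measurable_eval (hB _)).comp
      hη.measurable).const_mul _)).aestronglyMeasurable)
  have hre : ∀ F : ℝ≥0 → ℝ, ∏ i, F (e i) = ∏ c ∈ u.range, F c := fun F => by
    rw [← Finset.prod_coe_sort u.range, ← e.prod_comp]
  simp only [lap_eq_prod]
  have h1 : ∀ ω, ∏ c ∈ u.range, expNeg ((c : ℝ≥0∞) * (η ω).1 (u ⁻¹' {c})) =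
      ∏ i, expNeg ((e i : ℝ≥0) * (η ω).1 (u ⁻¹' {(e i : ℝ≥0)})) := fun ω =>
    (hre fun c => expNeg ((c : ℝ≥0∞) * (η ω).1 (u ⁻¹' {c}))).symm
  simp only [h1]
  refine hprod.trans ?_
  rw [integral_oneSubExp hu, ← Finset.sum_neg_distrib, Real.exp_sum]
  rw [← hre fun c => Real.exp (-((1 - Real.exp (-c)) * μ.real (u ⁻¹' {c})))]
  refine Finset.prod_congr rfl fun i _ => ?_
  by_cases hc : (e i : ℝ≥0) = 0
  · simp [hc]
  · exact hη.integral_expNeg (hB _) (measure_fiber_lt_top hu hc) _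

end IsPoissonProcess

/-! ### Monotone difference quotients. -/

lemma tendsto_mul_one_sub_exp (q : ℝ) :
    Filter.Tendsto (fun n : ℕ => ((n : ℝ) + 2) * (1 - Real.exp (-(q / (n + 2)))))
      Filter.atTop (𝓝 q) := by
  have h1 : HasDerivAt (fun r : ℝ => -Real.exp (-(q * r))) q 0 := by
    have := (((hasDerivAt_id (0 : ℝ)).const_mul q).neg.exp).neg
    have hq : -(Real.exp ((-fun y => q * y) (0 : ℝ)) * -q) = q := by simp
    simp only [id_eq, mul_one, hq] at this
    exact this
  have h2 := hasDerivAt_iff_tendsto_slope_zero.1 h1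
  have h3 : Filter.Tendsto (fun n : ℕ => ((n : ℝ) + 2)⁻¹) Filter.atTop (𝓝[≠] 0) := by
    refine tendsto_nhdsWithin_iff.2 ⟨?_, Filter.Eventually.of_forall fun n => ?_⟩
    · exact tendsto_inv_atTop_zero.comp
        (Filter.tendsto_atTop_add_const_right _ _ tendsto_natCast_atTop_atTop)
    · have : (0 : ℝ) < (n : ℝ) + 2 := by positivity
      exact (inv_pos.2 this).ne'
  refine (h2.comp h3).congr fun n => ?_
  simp only [Function.comp_apply, smul_eq_mul, inv_inv, zero_add, mul_zero, neg_zero,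
    Real.exp_zero, div_eq_mul_inv]
  ring

/-- The parameter `t` with `e^{-t} = (n + 1) / (n + 2)`. -/
noncomputable def stepParam (n : ℕ) : ℝ≥0 := Real.toNNReal (-Real.log (((n : ℝ) + 1) / (n + 2)))

lemma exp_neg_stepParam (n : ℕ) :
    Real.exp (-stepParam n) = ((n : ℝ) + 1) / (n + 2) := by
  have h : (0 : ℝ) < ((n : ℝ) + 1) / (n + 2) := by positivity
  have h1 : ((n : ℝ) + 1) / (n + 2) ≤ 1 := by
    rw [div_le_one (by positivity)]
    linarith
  rw [stepParam, Real.coe_toNNReal _ (by linarith [Real.log_nonpos h.le h1]), neg_neg,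
    Real.exp_log h]

lemma stepParam_ne_zero (n : ℕ) : stepParam n ≠ 0 := by
  intro h
  have := exp_neg_stepParam n
  rw [h, eq_div_iff (by positivity)] at this
  simp at this

/-- With `r = (n + 1) / (n + 2)` one has `1 - r = 1 / (n + 2)`, so the quotient is a geometric sum,
which increases to `k` as `r` increases to `1`. -/
lemma mul_one_sub_expNeg_natCast (n k : ℕ) :
    ((n : ℝ) + 2) * (1 - expNeg (stepParam n * ((k : ℕ∞) : ℝ≥0∞))) =
      ∑ i ∈ Finset.range k, (((n : ℝ) + 1) / (n + 2)) ^ i := by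
  have h := expNeg_coe (stepParam n * k)
  have h1 : expNeg (stepParam n * ((k : ℕ∞) : ℝ≥0∞)) = (((n : ℝ) + 1) / (n + 2)) ^ k := by
    rw [← exp_neg_stepParam, ← Real.exp_nat_mul]
    push_cast at h ⊢
    rw [h]
    congr 1
    ring
  have hn : (n : ℝ) + 2 ≠ 0 := by positivity
  rw [h1, ← mul_neg_geom_sum, ← mul_assoc]
  have : ((n : ℝ) + 2) * (1 - ((n : ℝ) + 1) / (n + 2)) = 1 := by
    field_simp
    ring
  rw [this, one_mul]

lemma monotone_mul_one_sub_expNeg (k : ℕ∞) :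
    Monotone fun n : ℕ =>
      ENNReal.ofReal (((n : ℝ) + 2) * (1 - expNeg (stepParam n * (k : ℝ≥0∞)))) := by
  have hs : ∀ n m : ℕ, n ≤ m → ((n : ℝ) + 1) / (n + 2) ≤ ((m : ℝ) + 1) / (m + 2) := by
    intro n m h
    have : (n : ℝ) ≤ m := by exact_mod_cast h
    rw [div_le_div_iff₀ (by positivity) (by positivity)]
    nlinarith
  intro n m h
  refine ENNReal.ofReal_le_ofReal ?_
  induction k with
  | top =>
    have : (n : ℝ) ≤ m := by exact_mod_cast h
    simpa [stepParam_ne_zero] using this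
  | coe k =>
    rw [mul_one_sub_expNeg_natCast, mul_one_sub_expNeg_natCast]
    exact Finset.sum_le_sum fun i _ => pow_le_pow_left₀ (by positivity) (hs n m h) _

lemma tendsto_mul_one_sub_expNeg (k : ℕ∞) :
    Filter.Tendsto (fun n : ℕ =>
      ENNReal.ofReal (((n : ℝ) + 2) * (1 - expNeg (stepParam n * (k : ℝ≥0∞)))))
      Filter.atTop (𝓝 (k : ℝ≥0∞)) := by
  induction k with
  | top =>
    simp only [ENat.toENNReal_top]
    have : Filter.Tendsto (fun n : ℕ => (n : ℝ) + 2) Filter.atTop Filter.atTop :=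
      Filter.tendsto_atTop_add_const_right _ _ tendsto_natCast_atTop_atTop
    simpa [stepParam_ne_zero] using this
  | coe k =>
    simp only [mul_one_sub_expNeg_natCast]
    have h1 : Filter.Tendsto (fun n : ℕ => ((n : ℝ) + 1) / (n + 2)) Filter.atTop (𝓝 1) := by
      have h2 : Filter.Tendsto (fun n : ℕ => 1 - ((n : ℝ) + 2)⁻¹) Filter.atTop (𝓝 (1 - 0)) :=
        tendsto_const_nhds.sub (tendsto_inv_atTop_zero.comp
          (Filter.tendsto_atTop_add_const_right _ _ tendsto_natCast_atTop_atTop))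
      rw [sub_zero] at h2
      refine h2.congr fun n => ?_
      have hn : (n : ℝ) + 2 ≠ 0 := by positivity
      field_simp
      ring
    have h3 : Filter.Tendsto (fun n : ℕ => ∑ i ∈ Finset.range k, (((n : ℝ) + 1) / (n + 2)) ^ i)
        Filter.atTop (𝓝 (∑ i ∈ Finset.range k, (1 : ℝ) ^ i)) :=
      tendsto_finsetSum _ fun i _ => h1.pow i
    have h4 := ENNReal.tendsto_ofReal h3
    simpa using h4

lemma ae_of_ae_restrict_spanningSets {X : Type*} [MeasurableSpace X] {μ : Measure X}
    [SigmaFinite μ] {p : X → Prop}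
    (hp : ∀ k, ∀ᵐ x ∂(μ.restrict (spanningSets μ k)), p x) : ∀ᵐ x ∂μ, p x := by
  have := (ae_restrict_iUnion_iff (μ := μ) (spanningSets μ) p).2 hp
  rwa [iUnion_spanningSets, Measure.restrict_univ] at this

/-! ### The Mecke equation and its consequences. -/

namespace CountingMeasures

variable {X : Type*} [MeasurableSpace X]

/-- The measure `ν` has the Laplace functional of a Poisson process with intensity `μ`. -/
def HasPoissonLaplace (μ : Measure X) (ν : Measure (CountingMeasures X)) : Prop :=
  ∀ u : SimpleFunc X ℝ≥0, μ (Function.support u) < ∞ →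
    ∫ χ, lap u χ ∂ν = Real.exp (-∫ x, oneSubExp u x ∂μ)

lemma integrable_lap (ν : Measure (CountingMeasures X)) [IsFiniteMeasure ν]
    (u : SimpleFunc X ℝ≥0) : Integrable (lap u) ν :=
  Integrable.of_bound (measurable_lap u).aestronglyMeasurable 1
    (Filter.Eventually.of_forall (norm_lap_le u))

lemma support_add_stepFun_lt_top {μ : Measure X} {u : SimpleFunc X ℝ≥0}
    (hu : μ (Function.support u) < ∞) {B : Set X} (hB : MeasurableSet B) (hμB : μ B < ∞)
    (t : ℝ≥0) : μ (Function.support (u + stepFun hB t)) < ∞ := by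
  refine (measure_mono fun x hx => ?_).trans_lt (measure_union_lt_top hu hμB)
  by_contra hc
  simp only [Set.mem_union, not_or, Function.mem_support, not_not] at hc
  apply hx
  simp [stepFun_apply, hc.1, hc.2]

/-- Since `e^{-t} = 1 - 1 / (n + 2)` for `t = stepParam n`, the increment is exact, with no error
term. -/
lemma oneSubExp_add_stepFun (u : SimpleFunc X ℝ≥0) {B : Set X} (hB : MeasurableSet B)
    (n : ℕ) (x : X) :
    oneSubExp (u + stepFun hB (stepParam n)) x =
      oneSubExp u x + B.indicator (fun x => Real.exp (-u x)) x / (n + 2) := by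
  simp only [oneSubExp, SimpleFunc.coe_add, Pi.add_apply, stepFun_apply]
  have hn : (n : ℝ) + 2 ≠ 0 := by positivity
  by_cases hx : x ∈ B
  · simp only [hx, Set.indicator_of_mem, NNReal.coe_add, neg_add, Real.exp_add,
      exp_neg_stepParam]
    field_simp
    ring
  · simp [hx]

section

variable {μ : Measure X} {ν : Measure (CountingMeasures X)} [IsProbabilityMeasure ν]

lemma integrableOn_exp_neg {B : Set X} (hμB : μ B < ∞) (u : SimpleFunc X ℝ≥0) :
    IntegrableOn (fun x => Real.exp (-u x)) B μ := by
  refine Measure.integrableOn_of_bounded (M := 1) hμB.ne ?_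
    (Filter.Eventually.of_forall fun x => ?_)
  · exact Measurable.aestronglyMeasurable (by fun_prop)
  · simp

/-- This differentiates the Laplace functional at `u` in the direction `1_B`. As `χ B` is an integer
or `∞`, the quotients increase to `χ B`, so monotone convergence applies without knowing beforehand
that `χ B` is integrable. -/
lemma lintegral_lap_mul_eval (h : HasPoissonLaplace μ ν) (u : SimpleFunc X ℝ≥0)
    (hu : μ (Function.support u) < ∞) {B : Set X} (hB : MeasurableSet B) (hμB : μ B < ∞) :
    ∫⁻ χ, ENNReal.ofReal (lap u χ) * χ.1 B ∂ν =
      ENNReal.ofReal (Real.exp (-∫ x, oneSubExp u x ∂μ) * ∫ x in B, Real.exp (-u x) ∂μ) := by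
  set q := ∫ x in B, Real.exp (-u x) ∂μ with hq
  have hk : ∀ χ : CountingMeasures X, ∃ k : ℕ∞, χ.1 B = (k : ℝ≥0∞) := fun χ => χ.2.2 B hB
  let G : ℕ → CountingMeasures X → ℝ≥0∞ := fun n χ =>
    ENNReal.ofReal (lap u χ) *
      ENNReal.ofReal (((n : ℝ) + 2) * (1 - expNeg (stepParam n * χ.1 B)))
  have hG : ∀ n, Measurable (G n) := fun n => by
    have h1 := (measurable_lap u).ennreal_ofReal
    have h2 : Measurable fun χ : CountingMeasures X => expNeg (stepParam n * χ.1 B) :=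
      measurable_expNeg.comp ((measurable_eval hB).const_mul _)
    exact h1.mul ((h2.const_sub 1).const_mul _).ennreal_ofReal
  have hlim := lintegral_tendsto_of_tendsto_of_monotone (μ := ν) (f := G)
    (F := fun χ => ENNReal.ofReal (lap u χ) * χ.1 B) (fun n => (hG n).aemeasurable)
    (Filter.Eventually.of_forall fun χ n m hnm => by
      obtain ⟨k, hk⟩ := hk χ
      simp only [G, hk]
      exact mul_le_mul' le_rfl (monotone_mul_one_sub_expNeg k hnm))
    (Filter.Eventually.of_forall fun χ => by
      obtain ⟨k, hk⟩ := hk χ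
      simp only [G, hk]
      exact ENNReal.Tendsto.const_mul (tendsto_mul_one_sub_expNeg k)
        (Or.inr ENNReal.ofReal_ne_top))
  refine tendsto_nhds_unique hlim ?_
  have hint : ∀ n, ∫⁻ χ, G n χ ∂ν = ENNReal.ofReal (Real.exp (-∫ x, oneSubExp u x ∂μ) *
      (((n : ℝ) + 2) * (1 - Real.exp (-(q / (n + 2)))))) := by
    intro n
    set v := u + stepFun hB (stepParam n)
    have h1 : ∀ χ, G n χ = ENNReal.ofReal (((n : ℝ) + 2) * (lap u χ - lap v χ)) := by
      intro χ
      simp only [G, v, lap_add, lap_stepFun]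
      rw [← ENNReal.ofReal_mul (lap_nonneg u χ)]
      congr 1
      ring
    simp only [h1]
    rw [← ofReal_integral_eq_lintegral_ofReal
      (f := fun χ => ((n : ℝ) + 2) * (lap u χ - lap v χ))
      (((integrable_lap ν u).sub (integrable_lap ν v)).const_mul _)
      (Filter.Eventually.of_forall fun χ => ?_), integral_const_mul,
      integral_sub (integrable_lap ν u) (integrable_lap ν v), h u hu,
      h v (support_add_stepFun_lt_top hu hB hμB _)]
    · have h2 : ∫ x, oneSubExp v x ∂μ = ∫ x, oneSubExp u x ∂μ + q / (n + 2) := by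
        simp only [v, oneSubExp_add_stepFun]
        rw [integral_add (integrable_oneSubExp hu)
          (((integrable_indicator_iff hB).2 (integrableOn_exp_neg hμB u)).div_const _),
          integral_div, integral_indicator hB]
      rw [h2, neg_add, Real.exp_add]
      congr 1
      ring
    · have h3 : lap v χ ≤ lap u χ := by
        simp only [v, lap_add, lap_stepFun]
        exact mul_le_of_le_one_right (lap_nonneg u χ) (expNeg_le_one _)
      have : 0 ≤ lap u χ - lap v χ := sub_nonneg.2 h3
      simp only [Pi.zero_apply]
      positivity
  simp only [hint]
  exact ENNReal.tendsto_ofReal ((tendsto_mul_one_sub_exp q).const_mul _)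

lemma lintegral_eval (h : HasPoissonLaplace μ ν) {B : Set X} (hB : MeasurableSet B)
    (hμB : μ B < ∞) : ∫⁻ χ, χ.1 B ∂ν = μ B := by
  have := lintegral_lap_mul_eval h 0 (by simp) hB hμB
  simpa [lap_zero, oneSubExp, measureReal_def, hμB.ne] using this

variable [SigmaFinite μ]

/-- The Mecke equation, as an identity of measures. -/
theorem map_addDirac_eq (h : HasPoissonLaplace μ ν) {B : Set X} (hB : MeasurableSet B)
    (hμB : μ B < ∞) :
    ((μ.restrict B).prod ν).map (fun p => p.2.addDirac p.1) =
      ν.withDensity (fun χ => χ.1 B) := by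
  have : IsFiniteMeasure (μ.restrict B) := ⟨by simpa using hμB⟩
  have : IsFiniteMeasure (ν.withDensity (fun χ => χ.1 B)) :=
    isFiniteMeasure_withDensity (by rw [lintegral_eval h hB hμB]; exact hμB.ne)
  -- On the left the Laplace functional factors, because `lap u` is multiplicative under adding
  -- `δ_x`; on the right it is the derivative computed above.
  refine ext_of_lap μ fun u hu => ?_
  rw [integral_map measurable_addDirac.aemeasurable (measurable_lap u).aestronglyMeasurable]
  simp only [lap_addDirac]
  rw [integral_prod_mul (μ := μ.restrict B) (ν := ν) (fun x => Real.exp (-u x)) (lap u),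
    h u hu, integral_eq_lintegral_of_nonneg_ae (Filter.Eventually.of_forall (lap_nonneg u))
    (measurable_lap u).aestronglyMeasurable,
    lintegral_withDensity_eq_lintegral_mul _ (measurable_eval hB)
      (measurable_lap u).ennreal_ofReal]
  have hcomm : ∫⁻ χ, ((fun χ : CountingMeasures X => χ.1 B) *
      fun χ => ENNReal.ofReal (lap u χ)) χ ∂ν = ∫⁻ χ, ENNReal.ofReal (lap u χ) * χ.1 B ∂ν :=
    lintegral_congr fun χ => mul_comm _ _
  rw [hcomm, lintegral_lap_mul_eval h u hu hB hμB, ENNReal.toReal_ofReal, mul_comm]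
  have : 0 ≤ ∫ x in B, Real.exp (-u x) ∂μ := integral_nonneg fun x => (Real.exp_pos _).le
  positivity

/-- The Mecke equation. -/
theorem lintegral_addDirac (h : HasPoissonLaplace μ ν) {B : Set X} (hB : MeasurableSet B)
    (hμB : μ B < ∞) {k : CountingMeasures X → ℝ≥0∞} (hk : Measurable k) :
    ∫⁻ x in B, ∫⁻ χ, k (χ.addDirac x) ∂ν ∂μ = ∫⁻ χ, χ.1 B * k χ ∂ν := by
  have h1 : ∫⁻ χ, k χ ∂(((μ.restrict B).prod ν).map (fun p => p.2.addDirac p.1)) =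
      ∫⁻ χ, k χ ∂(ν.withDensity (fun χ => χ.1 B)) := by rw [map_addDirac_eq h hB hμB]
  rw [lintegral_map hk measurable_addDirac,
    lintegral_prod (fun p : X × CountingMeasures X => k (p.2.addDirac p.1))
      (hk.comp measurable_addDirac).aemeasurable,
    lintegral_withDensity_eq_lintegral_mul _ (measurable_eval hB) hk] at h1
  exact h1

/-- By Mecke, `E χ B (χ B + c)^k = μ B · E (χ B + 1 + c)^k`; this shift is why the induction needs
every finite `c`. -/
lemma lintegral_eval_add_pow_lt_top (h : HasPoissonLaplace μ ν) {B : Set X}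
    (hB : MeasurableSet B) (hμB : μ B < ∞) (k : ℕ) (c : ℝ≥0∞) (hc : c < ∞) :
    ∫⁻ χ, (χ.1 B + c) ^ k ∂ν < ∞ := by
  induction k generalizing c with
  | zero => simp
  | succ k ih =>
    have hm : ∀ c : ℝ≥0∞, Measurable fun χ : CountingMeasures X => (χ.1 B + c) ^ k :=
      fun c => ((measurable_eval hB).add_const c).pow_const k
    have h1 : ∀ χ : CountingMeasures X, (χ.1 B + c) ^ (k + 1) =
        χ.1 B * (χ.1 B + c) ^ k + c * (χ.1 B + c) ^ k := fun χ => by ring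
    simp only [h1]
    rw [lintegral_add_right _ ((hm c).const_mul c), lintegral_const_mul _ (hm c),
      ← lintegral_addDirac h hB hμB (hm c)]
    have h2 : ∫⁻ x in B, ∫⁻ χ, ((χ.addDirac x).1 B + c) ^ k ∂ν ∂μ =
        ∫⁻ _ in B, ∫⁻ χ, (χ.1 B + (1 + c)) ^ k ∂ν ∂μ := by
      refine setLIntegral_congr_fun hB fun x hx => ?_
      simp only [addDirac_apply _ _ hB, Set.indicator_of_mem hx, Pi.one_apply, add_assoc]
    rw [h2, setLIntegral_const]
    exact ENNReal.add_lt_top.2 ⟨ENNReal.mul_lt_top (ih _ (by simp [hc])) hμB,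
      ENNReal.mul_lt_top hc (ih c hc)⟩

/-- For `x` distributed over `B`, the law of `χ + δ_x` has density `χ B` with respect to `ν`. This
makes differences of `ν`-classes of functions well defined almost everywhere. -/
lemma quasiMeasurePreserving_addDirac (h : HasPoissonLaplace μ ν) :
    Measure.QuasiMeasurePreserving (fun p : X × CountingMeasures X => p.2.addDirac p.1)
      (μ.prod ν) ν := by
  refine ⟨measurable_addDirac, Measure.AbsolutelyContinuous.mk fun A hA hνA => ?_⟩
  rw [Measure.map_apply measurable_addDirac hA, Measure.measure_prod_null (measurable_addDirac hA)]
  refine ae_of_ae_restrict_spanningSets fun k => ?_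
  have h2 := withDensity_absolutelyContinuous ν (fun χ => χ.1 (spanningSets μ k)) hνA
  rw [← map_addDirac_eq h (measurableSet_spanningSets μ k) (measure_spanningSets_lt_top μ k),
    Measure.map_apply measurable_addDirac hA,
    Measure.measure_prod_null (measurable_addDirac hA)] at h2
  exact h2

end

end CountingMeasures

/-! ### Local `L¹` bounds for iterated differences. -/

lemma lintegral_pi_succ {X : Type*} [MeasurableSpace X] (m : Measure X) [SigmaFinite m] (n : ℕ)
    {G : (Fin (n + 1) → X) → ℝ≥0∞} (hG : Measurable G) :
    ∫⁻ x, G x ∂(Measure.pi fun _ => m) =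
      ∫⁻ x, ∫⁻ a, G (Fin.cons a x) ∂m ∂(Measure.pi fun _ => m) := by
  have hmp := (measurePreserving_piFinSuccAbove (fun _ : Fin (n + 1) => m) 0).symm
  rw [← hmp.lintegral_comp hG, lintegral_prod_symm' (fun p => G
    ((MeasurableEquiv.piFinSuccAbove (fun _ => X) 0).symm p)) (hG.comp hmp.measurable)]
  refine lintegral_congr fun x => lintegral_congr fun a => congrArg G ?_
  exact Fin.insertNth_zero' a x

namespace CountingMeasures

variable {X : Type*} [MeasurableSpace X]

/-- `E D^n_x f`, where the expectation is with respect to `ν`. -/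
noncomputable def meanDiff (ν : Measure (CountingMeasures X)) (f : CountingMeasures X → ℝ) (n : ℕ)
    (x : Fin n → X) : ℝ :=
  ∫ χ, iterDiffOp f n x χ ∂ν

lemma meanDiff_smul (ν : Measure (CountingMeasures X)) (c : ℝ) (f : CountingMeasures X → ℝ)
    (n : ℕ) :
    meanDiff ν (c • f) n = c • meanDiff ν f n := by
  funext x
  simp only [meanDiff, iterDiffOp_smul, Pi.smul_apply, integral_smul]

variable {μ : Measure X} [SigmaFinite μ] {ν : Measure (CountingMeasures X)}
  [IsProbabilityMeasure ν]

/-- After the triangle inequality, Mecke gives a factor `χ B` for the shifted term and integration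
over `B` gives `μ B` for the other; together they form one more power of the weight. -/
lemma lintegral_diffOp_le (h : HasPoissonLaplace μ ν) {B : Set X} (hB : MeasurableSet B)
    (hμB : μ B < ∞) {f : CountingMeasures X → ℝ} (hf : Measurable f) (k : ℕ) :
    ∫⁻ x in B, ∫⁻ χ, (χ.1 B + μ B) ^ k * ‖diffOp x f χ‖ₑ ∂ν ∂μ ≤
      ∫⁻ χ, (χ.1 B + μ B) ^ (k + 1) * ‖f χ‖ₑ ∂ν := by
  have hw : Measurable fun χ : CountingMeasures X => (χ.1 B + μ B) ^ k :=
    ((measurable_eval hB).add_const _).pow_const k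
  have hm : Measurable fun χ : CountingMeasures X => (χ.1 B + μ B) ^ k * ‖f χ‖ₑ :=
    hw.mul hf.enorm
  calc ∫⁻ x in B, ∫⁻ χ, (χ.1 B + μ B) ^ k * ‖diffOp x f χ‖ₑ ∂ν ∂μ
      ≤ ∫⁻ x in B, (∫⁻ χ, ((χ.addDirac x).1 B + μ B) ^ k * ‖f (χ.addDirac x)‖ₑ ∂ν +
          ∫⁻ χ, (χ.1 B + μ B) ^ k * ‖f χ‖ₑ ∂ν) ∂μ := by
        refine lintegral_mono fun x => ?_
        rw [← lintegral_add_right _ hm]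
        refine lintegral_mono fun χ => ?_
        calc (χ.1 B + μ B) ^ k * ‖diffOp x f χ‖ₑ
            ≤ (χ.1 B + μ B) ^ k * (‖f (χ.addDirac x)‖ₑ + ‖f χ‖ₑ) := by
              gcongr
              exact enorm_sub_le
          _ ≤ _ := by
              rw [mul_add]
              -- The weight grows under adding `δ_x`, so it may be shifted along with `f` before
              -- applying Mecke.
              have : χ.1 B ≤ (χ.addDirac x).1 B := by
                rw [addDirac_apply _ _ hB]
                exact le_self_add
              exact add_le_add_left (mul_le_mul' (pow_le_pow_left' (add_le_add_left this _) k)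
                le_rfl) _
    _ = ∫⁻ χ, χ.1 B * ((χ.1 B + μ B) ^ k * ‖f χ‖ₑ) ∂ν +
          μ B * ∫⁻ χ, (χ.1 B + μ B) ^ k * ‖f χ‖ₑ ∂ν := by
        rw [lintegral_add_right _ measurable_const, lintegral_addDirac h hB hμB hm,
          setLIntegral_const, mul_comm (μ B)]
    _ = _ := by
        rw [← lintegral_const_mul _ hm, ← lintegral_add_right _ (hm.const_mul _)]
        refine lintegral_congr fun χ => ?_
        ring

lemma lintegral_iterDiffOp_le (h : HasPoissonLaplace μ ν) {B : Set X} (hB : MeasurableSet B)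
    (hμB : μ B < ∞) {f : CountingMeasures X → ℝ} (hf : Measurable f) (n k : ℕ) :
    ∫⁻ x, ∫⁻ χ, (χ.1 B + μ B) ^ k * ‖iterDiffOp f n x χ‖ₑ ∂ν
        ∂(Measure.pi fun _ : Fin n => μ.restrict B) ≤
      ∫⁻ χ, (χ.1 B + μ B) ^ (k + n) * ‖f χ‖ₑ ∂ν := by
  induction n generalizing k with
  | zero =>
    rw [Measure.pi_of_empty, lintegral_dirac]
    rfl
  | succ n ih =>
    have hm : Measurable fun x : Fin (n + 1) → X =>
        ∫⁻ χ, (χ.1 B + μ B) ^ k * ‖iterDiffOp f (n + 1) x χ‖ₑ ∂ν :=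
      Measurable.lintegral_prod_right' (f := fun p : (Fin (n + 1) → X) × CountingMeasures X =>
        (p.2.1 B + μ B) ^ k * ‖iterDiffOp f (n + 1) p.1 p.2‖ₑ)
        (((((measurable_eval hB).comp measurable_snd).add_const _).pow_const k).mul
          (measurable_iterDiffOp hf (n + 1)).enorm)
    rw [lintegral_pi_succ _ _ hm]
    refine (lintegral_mono fun x => ?_).trans ((ih (k + 1)).trans_eq ?_)
    · exact lintegral_diffOp_le h hB hμB
        ((measurable_iterDiffOp hf n).comp measurable_prodMk_left) k
    · rw [add_assoc, add_comm 1 n]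

/-- The constant in the bound of `E ∫_{B^n} |D^n f| dμ^n` by the `L²` norm of `f`. -/
noncomputable def diffBound (μ : Measure X) (ν : Measure (CountingMeasures X)) (B : Set X)
    (n : ℕ) : ℝ≥0∞ :=
  (∫⁻ χ, ((χ.1 B + μ B) ^ n) ^ (2 : ℝ) ∂ν) ^ (1 / 2 : ℝ)

lemma diffBound_lt_top (h : HasPoissonLaplace μ ν) {B : Set X} (hB : MeasurableSet B)
    (hμB : μ B < ∞) (n : ℕ) : diffBound μ ν B n < ∞ := by
  refine ENNReal.rpow_lt_top_of_nonneg (by norm_num) (LT.lt.ne ?_)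
  have : ∀ χ : CountingMeasures X, ((χ.1 B + μ B) ^ n) ^ (2 : ℝ) = (χ.1 B + μ B) ^ (n * 2) :=
    fun χ => by rw [ENNReal.rpow_two, ← pow_mul]
  simp only [this]
  exact lintegral_eval_add_pow_lt_top h hB hμB _ _ hμB

/-- Cauchy–Schwarz separates the `n`-th power of the weight from `f`. -/
lemma lintegral_iterDiffOp_le_eLpNorm_of_measurable (h : HasPoissonLaplace μ ν) {B : Set X}
    (hB : MeasurableSet B) (hμB : μ B < ∞) {f : CountingMeasures X → ℝ} (hf : Measurable f)
    (n : ℕ) :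
    ∫⁻ x, ∫⁻ χ, ‖iterDiffOp f n x χ‖ₑ ∂ν ∂(Measure.pi fun _ : Fin n => μ.restrict B) ≤
      diffBound μ ν B n * eLpNorm f 2 ν := by
  have h1 := lintegral_iterDiffOp_le h hB hμB hf n 0
  simp only [pow_zero, one_mul, zero_add] at h1
  refine h1.trans ?_
  have h2 := ENNReal.lintegral_mul_le_Lp_mul_Lq ν Real.HolderConjugate.two_two
    (f := fun χ : CountingMeasures X => (χ.1 B + μ B) ^ n) (g := fun χ => ‖f χ‖ₑ)
    (((measurable_eval hB).add_const _).pow_const n).aemeasurable hf.enorm.aemeasurable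
  refine h2.trans_eq ?_
  rw [eLpNorm_eq_lintegral_rpow_enorm_toReal (by norm_num) (by norm_num)]
  rfl

lemma quasiMeasurePreserving_tail (n : ℕ) :
    Measure.QuasiMeasurePreserving
      (fun p : (Fin (n + 1) → X) × CountingMeasures X => ((fun i : Fin n => p.1 i.succ), p.2))
      ((Measure.pi fun _ => μ).prod ν) ((Measure.pi fun _ => μ).prod ν) := by
  have h1 := (measurePreserving_piFinSuccAbove (fun _ : Fin (n + 1) => μ) 0).quasiMeasurePreserving
  have h2 := (Measure.quasiMeasurePreserving_snd (μ := μ)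
    (ν := Measure.pi fun _ : Fin n => μ)).comp h1
  exact QuasiMeasurePreserving.prodMap h2 (Measure.QuasiMeasurePreserving.id ν)

lemma quasiMeasurePreserving_tail_addDirac (h : HasPoissonLaplace μ ν) (n : ℕ) :
    Measure.QuasiMeasurePreserving
      (fun p : (Fin (n + 1) → X) × CountingMeasures X =>
        ((fun i : Fin n => p.1 i.succ), p.2.addDirac (p.1 0)))
      ((Measure.pi fun _ => μ).prod ν) ((Measure.pi fun _ => μ).prod ν) := by
  have h1 := (measurePreserving_piFinSuccAbove (fun _ : Fin (n + 1) => μ) 0).quasiMeasurePreserving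
  have h2 := (Measure.measurePreserving_swap (μ := μ)
    (ν := Measure.pi fun _ : Fin n => μ)).quasiMeasurePreserving.comp h1
  have h3 := QuasiMeasurePreserving.prodMap h2 (Measure.QuasiMeasurePreserving.id ν)
  have h4 := (measurePreserving_prodAssoc (Measure.pi fun _ : Fin n => μ) μ
    ν).quasiMeasurePreserving.comp h3
  exact (QuasiMeasurePreserving.prodMap
    (Measure.QuasiMeasurePreserving.id (Measure.pi fun _ : Fin n => μ))
    (quasiMeasurePreserving_addDirac h)).comp h4

/-- The outer difference evaluates the inner one at `χ` and at `χ + δ_{x 0}`; both maps pull null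
sets back to null sets. -/
lemma ae_prod_iterDiffOp_eq (h : HasPoissonLaplace μ ν) {f g : CountingMeasures X → ℝ}
    (hfg : f =ᵐ[ν] g) (n : ℕ) :
    ∀ᵐ p ∂((Measure.pi fun _ : Fin n => μ).prod ν),
      iterDiffOp f n p.1 p.2 = iterDiffOp g n p.1 p.2 := by
  induction n with
  | zero => exact Measure.quasiMeasurePreserving_snd.ae hfg
  | succ n ih =>
    filter_upwards [(quasiMeasurePreserving_tail n).ae ih,
      (quasiMeasurePreserving_tail_addDirac h n).ae ih] with p h1 h2
    simp only [iterDiffOp, diffOp] at h1 h2 ⊢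
    rw [h1, h2]

lemma ae_iterDiffOp_ae_eq (h : HasPoissonLaplace μ ν) {f g : CountingMeasures X → ℝ}
    (hfg : f =ᵐ[ν] g) (n : ℕ) :
    ∀ᵐ x ∂(Measure.pi fun _ : Fin n => μ), iterDiffOp f n x =ᵐ[ν] iterDiffOp g n x :=
  Measure.ae_ae_of_ae_prod (ae_prod_iterDiffOp_eq h hfg n)

lemma meanDiff_congr_ae (h : HasPoissonLaplace μ ν) {f g : CountingMeasures X → ℝ}
    (hfg : f =ᵐ[ν] g) (n : ℕ) :
    meanDiff ν f n =ᵐ[Measure.pi fun _ : Fin n => μ] meanDiff ν g n := by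
  filter_upwards [ae_iterDiffOp_ae_eq h hfg n] with x hx using integral_congr_ae hx

lemma aestronglyMeasurable_meanDiff (h : HasPoissonLaplace μ ν) {f : CountingMeasures X → ℝ}
    (hf : AEStronglyMeasurable f ν) (n : ℕ) :
    AEStronglyMeasurable (meanDiff ν f n) (Measure.pi fun _ : Fin n => μ) := by
  have hm := measurable_iterDiffOp hf.stronglyMeasurable_mk.measurable n
  exact ⟨meanDiff ν (hf.mk f) n, hm.stronglyMeasurable.integral_prod_right',
    meanDiff_congr_ae h hf.ae_eq_mk n⟩

lemma pi_restrict (B : Set X) (n : ℕ) :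
    Measure.pi (fun _ : Fin n => μ.restrict B) =
      (Measure.pi fun _ : Fin n => μ).restrict (Set.univ.pi fun _ => B) :=
  (Measure.restrict_pi_pi (fun _ : Fin n => μ) (fun _ => B)).symm

lemma lintegral_iterDiffOp_le_eLpNorm (h : HasPoissonLaplace μ ν) {B : Set X}
    (hB : MeasurableSet B) (hμB : μ B < ∞) {f : CountingMeasures X → ℝ}
    (hf : AEStronglyMeasurable f ν) (n : ℕ) :
    ∫⁻ x in Set.univ.pi fun _ => B, ∫⁻ χ, ‖iterDiffOp f n x χ‖ₑ ∂ν
        ∂(Measure.pi fun _ : Fin n => μ) ≤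
      diffBound μ ν B n * eLpNorm f 2 ν := by
  rw [eLpNorm_congr_ae hf.ae_eq_mk]
  refine le_trans (le_of_eq ?_) (lintegral_iterDiffOp_le_eLpNorm_of_measurable h hB hμB
    hf.stronglyMeasurable_mk.measurable n)
  rw [pi_restrict]
  refine lintegral_congr_ae (ae_restrict_of_ae ?_)
  filter_upwards [ae_iterDiffOp_ae_eq h hf.ae_eq_mk n] with x hx
  refine lintegral_congr_ae ?_
  filter_upwards [hx] with χ hχ
  rw [hχ]

lemma lintegral_meanDiff_le (h : HasPoissonLaplace μ ν) {B : Set X}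
    (hB : MeasurableSet B) (hμB : μ B < ∞) {f : CountingMeasures X → ℝ}
    (hf : AEStronglyMeasurable f ν) (n : ℕ) :
    ∫⁻ x in Set.univ.pi fun _ => B, ‖meanDiff ν f n x‖ₑ ∂(Measure.pi fun _ : Fin n => μ) ≤
      diffBound μ ν B n * eLpNorm f 2 ν :=
  (lintegral_mono fun _ => enorm_integral_le_lintegral_enorm _).trans
    (lintegral_iterDiffOp_le_eLpNorm h hB hμB hf n)

lemma ae_pi_of_ae_restrict_spanningSets {n : ℕ} {p : (Fin n → X) → Prop}
    (hp : ∀ k, ∀ᵐ x ∂((Measure.pi fun _ : Fin n => μ).restrict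
      (Set.univ.pi fun _ => spanningSets μ k)), p x) :
    ∀ᵐ x ∂(Measure.pi fun _ : Fin n => μ), p x := by
  have := (ae_restrict_iUnion_iff (μ := Measure.pi fun _ : Fin n => μ)
    (fun k => Set.univ.pi fun _ => spanningSets μ k) p).2 hp
  rwa [Set.iUnion_univ_pi_of_monotone (fun _ => monotone_spanningSets μ),
    iUnion_spanningSets, Set.pi_univ, Measure.restrict_univ] at this

lemma ae_integrable_iterDiffOp (h : HasPoissonLaplace μ ν) {f : CountingMeasures X → ℝ}
    (hf : MemLp f 2 ν) (n : ℕ) :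
    ∀ᵐ x ∂(Measure.pi fun _ : Fin n => μ), Integrable (iterDiffOp f n x) ν := by
  have hm := measurable_iterDiffOp hf.1.stronglyMeasurable_mk.measurable n
  have hF : Measurable fun x : Fin n → X => ∫⁻ χ, ‖iterDiffOp (hf.1.mk f) n x χ‖ₑ ∂ν :=
    hm.enorm.lintegral_prod_right'
  have hfin : ∀ᵐ x ∂(Measure.pi fun _ : Fin n => μ),
      ∫⁻ χ, ‖iterDiffOp (hf.1.mk f) n x χ‖ₑ ∂ν < ∞ := by
    refine ae_pi_of_ae_restrict_spanningSets fun k => ae_lt_top hF (LT.lt.ne ?_)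
    refine (lintegral_iterDiffOp_le_eLpNorm h (measurableSet_spanningSets μ k)
      (measure_spanningSets_lt_top μ k) hf.1.stronglyMeasurable_mk.aestronglyMeasurable
      n).trans_lt (ENNReal.mul_lt_top (diffBound_lt_top h (measurableSet_spanningSets μ k)
      (measure_spanningSets_lt_top μ k) n) ?_)
    rw [← eLpNorm_congr_ae hf.1.ae_eq_mk]
    exact hf.2
  filter_upwards [hfin, ae_iterDiffOp_ae_eq h hf.1.ae_eq_mk n] with x hx1 hx2
  exact Integrable.congr ⟨(hm.comp measurable_prodMk_left).aestronglyMeasurable, hx1⟩ hx2.symm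

lemma meanDiff_add_ae (h : HasPoissonLaplace μ ν) {f g : CountingMeasures X → ℝ}
    (hf : MemLp f 2 ν) (hg : MemLp g 2 ν) (n : ℕ) :
    meanDiff ν (f + g) n =ᵐ[Measure.pi fun _ : Fin n => μ] meanDiff ν f n + meanDiff ν g n := by
  filter_upwards [ae_integrable_iterDiffOp h hf n, ae_integrable_iterDiffOp h hg n] with x h1 h2
  simp only [meanDiff, iterDiffOp_add, Pi.add_apply]
  exact integral_add h1 h2

end CountingMeasures

/-! ### Extending an isometry from a total family. -/

section Isometry

variable {ι E F : Type*} [NormedAddCommGroup E] [InnerProductSpace ℝ E]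
  [NormedAddCommGroup F] [InnerProductSpace ℝ F]

open scoped RealInnerProductSpace

/-- The closed subspace of `E × F` generated by a family of pairs. -/
def closedGraph (p : ι → E × F) : Submodule ℝ (E × F) :=
  (Submodule.span ℝ (Set.range p)).topologicalClosure

lemma closedGraph_le {p : ι → E × F} {W : Submodule ℝ (E × F)} (hW : IsClosed (W : Set (E × F)))
    (h : ∀ i, p i ∈ W) : closedGraph p ≤ W :=
  Submodule.topologicalClosure_minimal _ (Submodule.span_le.2 (Set.range_subset_iff.2 h)) hW

lemma mem_closedGraph (p : ι → E × F) (i : ι) : p i ∈ closedGraph p :=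
  Submodule.le_topologicalClosure _ (Submodule.subset_span ⟨i, rfl⟩)

/-- The subspace of pairs `a` with `⟪a.1, b.1⟫ = ⟪a.2, b.2⟫`. -/
def innerEqSubmodule (b : E × F) : Submodule ℝ (E × F) where
  carrier := {a | ⟪a.1, b.1⟫ = ⟪a.2, b.2⟫}
  zero_mem' := by simp
  add_mem' := by
    intro a a' ha ha'
    simp only [Set.mem_ofPred_eq] at ha ha' ⊢
    simp only [Prod.fst_add, Prod.snd_add, inner_add_left, ha, ha']
  smul_mem' := by
    intro c a ha
    simp only [Set.mem_ofPred_eq] at ha ⊢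
    simp only [Prod.smul_fst, Prod.smul_snd, real_inner_smul_left, ha]

lemma isClosed_innerEqSubmodule (b : E × F) :
    IsClosed (innerEqSubmodule b : Set (E × F)) :=
  isClosed_eq (f := fun a : E × F => ⟪a.1, b.1⟫) (g := fun a : E × F => ⟪a.2, b.2⟫)
    (by fun_prop) (by fun_prop)

/-- The identity is linear and closed in each argument, so it extends from generators one argument
at a time. -/
lemma inner_eq_of_mem_closedGraph {p : ι → E × F}
    (hp : ∀ i j, ⟪(p i).1, (p j).1⟫ = ⟪(p i).2, (p j).2⟫) {a b : E × F}
    (ha : a ∈ closedGraph p) (hb : b ∈ closedGraph p) : ⟪a.1, b.1⟫ = ⟪a.2, b.2⟫ := by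
  have h1 : ∀ j, a ∈ innerEqSubmodule (p j) := fun j =>
    closedGraph_le (isClosed_innerEqSubmodule _) (fun i => hp i j) ha
  have h2 : b ∈ innerEqSubmodule a :=
    closedGraph_le (isClosed_innerEqSubmodule _) (fun j => by
      change ⟪(p j).1, a.1⟫ = ⟪(p j).2, a.2⟫
      rw [real_inner_comm, real_inner_comm a.2]
      exact h1 j) hb
  rw [real_inner_comm, real_inner_comm b.2]
  exact h2

/-- The first projection is isometric on the complete space `closedGraph p`, so its range is closed;
totality makes the orthogonal complement of the range zero. -/
lemma exists_mem_closedGraph [CompleteSpace E] [CompleteSpace F] {p : ι → E × F}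
    (hp : ∀ i j, ⟪(p i).1, (p j).1⟫ = ⟪(p i).2, (p j).2⟫)
    (htot : ∀ e : E, (∀ i, ⟪(p i).1, e⟫ = 0) → e = 0) (e : E) :
    ∃ f : F, (e, f) ∈ closedGraph p := by
  -- The product carries the sup norm, and the two components of `a` have equal norms.
  have hnorm : ∀ a ∈ closedGraph p, ‖a.1‖ = ‖a‖ := by
    intro a ha
    have := inner_eq_of_mem_closedGraph hp ha ha
    rw [real_inner_self_eq_norm_sq, real_inner_self_eq_norm_sq,
      sq_eq_sq₀ (norm_nonneg _) (norm_nonneg _)] at this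
    rw [Prod.norm_def, ← this, max_self]
  let L : closedGraph p →ₗᵢ[ℝ] E :=
    { (LinearMap.fst ℝ E F).comp (closedGraph p).subtype with
      norm_map' := fun a => hnorm a.1 a.2 }
  have hclosed : IsClosed (closedGraph p : Set (E × F)) :=
    Submodule.isClosed_topologicalClosure _
  have : CompleteSpace (closedGraph p) := hclosed.completeSpace_coe
  have hrange : IsClosed (LinearMap.range L.toLinearMap : Set E) := by
    rw [LinearMap.coe_range]
    exact L.isometry.isClosedEmbedding.isClosed_range
  have htop : LinearMap.range L.toLinearMap = ⊤ := by
    rw [← hrange.submodule_topologicalClosure_eq, Submodule.topologicalClosure_eq_top_iff,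
      Submodule.eq_bot_iff]
    intro e he
    exact htot e fun i => he _ ⟨⟨p i, mem_closedGraph p i⟩, rfl⟩
  have he : e ∈ LinearMap.range L.toLinearMap := htop ▸ Submodule.mem_top
  obtain ⟨⟨a, ha⟩, rfl⟩ := he
  exact ⟨a.2, ha⟩

end Isometry

/-! ### Exponential functionals in the Fock space. -/

namespace CountingMeasures

variable {X : Type*} [MeasurableSpace X]

/-- The Fock space over `L²(μ)`, with the components not required to be symmetric. -/
abbrev FockSpace (μ : Measure X) : Type _ :=
  lp (fun n : ℕ => Lp ℝ 2 (Measure.pi fun _ : Fin n => μ)) 2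

variable {μ : Measure X}

open scoped RealInnerProductSpace

/-- The function `(x_1, …, x_n) ↦ E D^n_x (lap u)`, divided by `√n!`. -/
noncomputable def lapCoeff (μ : Measure X) (u : SimpleFunc X ℝ≥0) (n : ℕ) (x : Fin n → X) : ℝ :=
  (√(n ! : ℝ))⁻¹ * Real.exp (-∫ x, oneSubExp u x ∂μ) * ∏ i, (Real.exp (-u (x i)) - 1)

lemma lapCoeff_mul (u v : SimpleFunc X ℝ≥0) (n : ℕ) (x : Fin n → X) :
    lapCoeff μ u n x * lapCoeff μ v n x =
      (Real.exp (-∫ x, oneSubExp u x ∂μ) * Real.exp (-∫ x, oneSubExp v x ∂μ) / n !) *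
        ∏ i, (oneSubExp u (x i) * oneSubExp v (x i)) := by
  have h1 : ∏ i, (oneSubExp u (x i) * oneSubExp v (x i)) =
      (∏ i, (Real.exp (-u (x i)) - 1)) * ∏ i, (Real.exp (-v (x i)) - 1) := by
    rw [← Finset.prod_mul_distrib]
    refine Finset.prod_congr rfl fun i _ => ?_
    simp only [oneSubExp]
    ring
  have h2 : (√(n ! : ℝ))⁻¹ * (√(n ! : ℝ))⁻¹ = (n ! : ℝ)⁻¹ := by
    rw [← mul_inv, Real.mul_self_sqrt (Nat.cast_nonneg _)]
  rw [h1, div_eq_mul_inv, ← h2]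
  simp only [lapCoeff]
  ring

lemma integrable_oneSubExp_mul {u : SimpleFunc X ℝ≥0} (hu : μ (Function.support u) < ∞)
    (v : SimpleFunc X ℝ≥0) : Integrable (fun x => oneSubExp u x * oneSubExp v x) μ :=
  (integrable_oneSubExp hu).mul_bdd (c := 1) (measurable_oneSubExp v).aestronglyMeasurable
    (Filter.Eventually.of_forall fun x => by
      rw [Real.norm_of_nonneg (oneSubExp_nonneg v x)]
      exact oneSubExp_le_one v x)

lemma measurable_lapCoeff (u : SimpleFunc X ℝ≥0) (n : ℕ) : Measurable (lapCoeff μ u n) := by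
  unfold lapCoeff
  refine Measurable.const_mul (Finset.measurable_prod _ fun i _ => ?_) _
  have : Measurable fun x : Fin n → X => u (x i) := u.measurable.comp (measurable_pi_apply i)
  fun_prop

lemma support_add_lt_top {u v : SimpleFunc X ℝ≥0} (hu : μ (Function.support u) < ∞)
    (hv : μ (Function.support v) < ∞) : μ (Function.support (u + v)) < ∞ :=
  (measure_mono (by rw [SimpleFunc.coe_add]; exact Function.support_add u v)).trans_lt
    (measure_union_lt_top hu hv)

variable [SigmaFinite μ]

lemma memLp_lapCoeff {u : SimpleFunc X ℝ≥0} (hu : μ (Function.support u) < ∞) (n : ℕ) :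
    MemLp (lapCoeff μ u n) 2 (Measure.pi fun _ => μ) := by
  rw [memLp_two_iff_integrable_sq (measurable_lapCoeff u n).aestronglyMeasurable]
  simp only [sq, lapCoeff_mul]
  exact (Integrable.fintype_prod fun _ => integrable_oneSubExp_mul hu u).const_mul _

lemma integral_lapCoeff_mul (u v : SimpleFunc X ℝ≥0) (n : ℕ) :
    ∫ x, lapCoeff μ u n x * lapCoeff μ v n x ∂(Measure.pi fun _ => μ) =
      Real.exp (-∫ x, oneSubExp u x ∂μ) * Real.exp (-∫ x, oneSubExp v x ∂μ) *
        ((∫ x, oneSubExp u x * oneSubExp v x ∂μ) ^ n / n !) := by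
  simp only [lapCoeff_mul]
  rw [integral_const_mul, integral_fintype_prod_eq_pow (fun x => oneSubExp u x * oneSubExp v x),
    Fintype.card_fin]
  ring

lemma inner_toLp {α : Type*} [MeasurableSpace α] {m : Measure α} {f g : α → ℝ}
    (hf : MemLp f 2 m) (hg : MemLp g 2 m) : ⟪hf.toLp f, hg.toLp g⟫ = ∫ x, f x * g x ∂m := by
  rw [L2.inner_def]
  refine integral_congr_ae ?_
  filter_upwards [hf.coeFn_toLp, hg.coeFn_toLp] with x h1 h2
  simp only [h1, h2, RCLike.inner_apply, conj_trivial, mul_comm]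

lemma hasSum_exp_div (c t : ℝ) : HasSum (fun n : ℕ => c * (t ^ n / n !)) (c * Real.exp t) := by
  rw [Real.exp_eq_exp_ℝ]
  exact (NormedSpace.expSeries_div_hasSum_exp t).mul_left c

/-- The element of the Fock space corresponding to `lap u`. -/
noncomputable def fockLap (u : {u : SimpleFunc X ℝ≥0 // μ (Function.support u) < ∞}) :
    FockSpace μ :=
  ⟨fun n => (memLp_lapCoeff u.2 n).toLp _, by
    refine memℓp_gen ?_
    have h : ∀ n, ‖(memLp_lapCoeff u.2 n).toLp (lapCoeff μ u.1 n)‖ ^ (2 : ℝ≥0∞).toReal =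
        ∫ x, lapCoeff μ u.1 n x * lapCoeff μ u.1 n x ∂(Measure.pi fun _ => μ) := by
      intro n
      rw [← inner_toLp (memLp_lapCoeff u.2 n) (memLp_lapCoeff u.2 n), real_inner_self_eq_norm_sq]
      simp
    simp only [h, integral_lapCoeff_mul]
    exact (hasSum_exp_div _ _).summable⟩

lemma inner_fockLap (u v : {u : SimpleFunc X ℝ≥0 // μ (Function.support u) < ∞}) :
    ⟪fockLap u, fockLap v⟫ =
      Real.exp (-∫ x, oneSubExp u.1 x ∂μ) * Real.exp (-∫ x, oneSubExp v.1 x ∂μ) *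
        Real.exp (∫ x, oneSubExp u.1 x * oneSubExp v.1 x ∂μ) := by
  refine (lp.hasSum_inner (𝕜 := ℝ) (fockLap u) (fockLap v)).unique ?_
  have h : ∀ n, ⟪fockLap u n, fockLap v n⟫ =
      ∫ x, lapCoeff μ u.1 n x * lapCoeff μ v.1 n x ∂(Measure.pi fun _ => μ) := fun n =>
    inner_toLp (memLp_lapCoeff u.2 n) (memLp_lapCoeff v.2 n)
  simp only [h, integral_lapCoeff_mul]
  exact hasSum_exp_div _ _

lemma integral_lap_withDensity (ν : Measure (CountingMeasures X)) (h : CountingMeasures X → ℝ)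
    (hm : Measurable h) (u : SimpleFunc X ℝ≥0) :
    ∫ χ, lap u χ ∂(ν.withDensity fun χ => ENNReal.ofReal (h χ)) =
      ∫ χ, max (h χ) 0 * lap u χ ∂ν := by
  rw [integral_withDensity_eq_integral_toReal_smul hm.ennreal_ofReal
    (Filter.Eventually.of_forall fun _ => ENNReal.ofReal_lt_top)]
  refine integral_congr_ae (Filter.Eventually.of_forall fun χ => ?_)
  simp only [ENNReal.toReal_ofReal', smul_eq_mul]

variable {ν : Measure (CountingMeasures X)} [IsProbabilityMeasure ν]

lemma memLp_lap (ν : Measure (CountingMeasures X)) [IsFiniteMeasure ν] (u : SimpleFunc X ℝ≥0) :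
    MemLp (lap u) 2 ν :=
  MemLp.of_bound (measurable_lap u).aestronglyMeasurable 1
    (Filter.Eventually.of_forall (norm_lap_le u))

/-- The pair of an exponential functional and its image in the Fock space. -/
noncomputable def lapPair (ν : Measure (CountingMeasures X)) [IsFiniteMeasure ν]
    (u : {u : SimpleFunc X ℝ≥0 // μ (Function.support u) < ∞}) :
    Lp ℝ 2 ν × FockSpace μ :=
  ((memLp_lap ν u.1).toLp _, fockLap u)

/-- With `a = 1 - e^{-u}` and `b = 1 - e^{-v}`, one has `1 - e^{-(u+v)} = a + b - ab`; the `ab` term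
produces the exponential of the mixed integral on the Fock side. -/
lemma inner_lapPair (h : HasPoissonLaplace μ ν)
    (u v : {u : SimpleFunc X ℝ≥0 // μ (Function.support u) < ∞}) :
    ⟪(lapPair ν u).1, (lapPair ν v).1⟫ = ⟪(lapPair ν u).2, (lapPair ν v).2⟫ := by
  simp only [lapPair]
  rw [inner_toLp, inner_fockLap]
  simp only [← lap_add]
  rw [h _ (support_add_lt_top u.2 v.2), ← Real.exp_add, ← Real.exp_add]
  have h1 : ∀ x, oneSubExp (u.1 + v.1) x =
      oneSubExp u.1 x + oneSubExp v.1 x - oneSubExp u.1 x * oneSubExp v.1 x := by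
    intro x
    simp only [oneSubExp, SimpleFunc.coe_add, Pi.add_apply, NNReal.coe_add, neg_add, Real.exp_add]
    ring
  simp only [h1]
  rw [integral_sub (f := fun x => oneSubExp u.1 x + oneSubExp v.1 x)
    ((integrable_oneSubExp u.2).add (integrable_oneSubExp v.2))
    (integrable_oneSubExp_mul u.2 v.1), integral_add (integrable_oneSubExp u.2)
    (integrable_oneSubExp v.2)]
  congr 1
  ring

/-- The exponential functionals are total in `L²`. -/
lemma eq_zero_of_inner_lap (μ : Measure X) [SigmaFinite μ] (h : Lp ℝ 2 ν)
    (hh : ∀ u : {u : SimpleFunc X ℝ≥0 // μ (Function.support u) < ∞},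
      ⟪(lapPair ν u).1, h⟫ = 0) : h = 0 := by
  have hm : Measurable h := (Lp.stronglyMeasurable h).measurable
  have hi : Integrable h ν := (Lp.memLp h).integrable (by norm_num)
  have hint : ∀ u : SimpleFunc X ℝ≥0, μ (Function.support u) < ∞ →
      ∫ χ, h χ * lap u χ ∂ν = 0 := by
    intro u hu
    rw [← hh ⟨u, hu⟩, L2.inner_def]
    refine integral_congr_ae ?_
    filter_upwards [(memLp_lap ν u).coeFn_toLp] with χ hχ
    simp only [lapPair, hχ, RCLike.inner_apply, conj_trivial]
  have hf1 := isFiniteMeasure_withDensity_ofReal hi.2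
  have hf2 := isFiniteMeasure_withDensity_ofReal hi.neg.2
  -- Orthogonality says that the positive and negative parts of `h`, as densities, have equal
  -- Laplace functionals.
  have heq : (ν.withDensity fun χ => ENNReal.ofReal (h χ)) =
      ν.withDensity fun χ => ENNReal.ofReal ((-h : CountingMeasures X → ℝ) χ) := by
    refine ext_of_lap μ fun u hu => ?_
    rw [integral_lap_withDensity ν _ hm, integral_lap_withDensity ν _ hm.neg]
    refine sub_eq_zero.1 ?_
    have hb : ∀ g : CountingMeasures X → ℝ, Integrable g ν →
        Integrable (fun χ => g χ * lap u χ) ν := fun g hg =>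
      hg.mul_bdd (c := 1) (measurable_lap u).aestronglyMeasurable
        (Filter.Eventually.of_forall (norm_lap_le u))
    rw [← integral_sub (hb _ hi.pos_part) (hb _ hi.neg.pos_part)]
    refine Eq.trans ?_ (hint u hu)
    refine integral_congr_ae (Filter.Eventually.of_forall fun χ => ?_)
    simp only [Pi.neg_apply]
    rw [← sub_mul]
    congr 1
    rcases le_total (h χ) 0 with h0 | h0
    · rw [max_eq_right h0, max_eq_left (neg_nonneg.2 h0)]
      ring
    · rw [max_eq_left h0, max_eq_right (neg_nonpos.2 h0)]
      ring
  have hae := (withDensity_eq_iff hm.ennreal_ofReal.aemeasurable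
    hm.neg.ennreal_ofReal.aemeasurable hi.lintegral_lt_top.ne).1 heq
  rw [Lp.eq_zero_iff_ae_eq_zero]
  filter_upwards [hae] with χ hχ
  simp only [Pi.neg_apply, Pi.zero_apply] at hχ ⊢
  rcases le_total (h χ) 0 with h0 | h0
  · rw [ENNReal.ofReal_of_nonpos h0, eq_comm, ENNReal.ofReal_eq_zero] at hχ
    linarith
  · rw [ENNReal.ofReal_of_nonpos (neg_nonpos.2 h0), ENNReal.ofReal_eq_zero] at hχ
    exact le_antisymm hχ h0

end CountingMeasures

/-! ### Identifying the components of the isometry. -/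

namespace CountingMeasures

variable {X : Type*} [MeasurableSpace X] {μ : Measure X} {ν : Measure (CountingMeasures X)}

open scoped RealInnerProductSpace

lemma meanDiff_lap (h : HasPoissonLaplace μ ν) {u : SimpleFunc X ℝ≥0}
    (hu : μ (Function.support u) < ∞) (n : ℕ) (x : Fin n → X) :
    meanDiff ν (lap u) n x = √(n ! : ℝ) * lapCoeff μ u n x := by
  have hn : √(n ! : ℝ) ≠ 0 := (Real.sqrt_pos.2 (by positivity)).ne'
  simp only [meanDiff, iterDiffOp_lap, lapCoeff]
  rw [integral_const_mul, h u hu]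
  field_simp

variable [SigmaFinite μ] [IsProbabilityMeasure ν]

/-- The difference between `E D^n f` and `√n!` times the `n`-th component of `F`. -/
noncomputable def fockDefect (a : Lp ℝ 2 ν × FockSpace μ) (n : ℕ) (x : Fin n → X) : ℝ :=
  meanDiff ν a.1 n x - √(n ! : ℝ) * a.2 n x

lemma fockDefect_add (h : HasPoissonLaplace μ ν) (a b : Lp ℝ 2 ν × FockSpace μ) (n : ℕ) :
    fockDefect (a + b) n =ᵐ[Measure.pi fun _ : Fin n => μ] fockDefect a n + fockDefect b n := by
  filter_upwards [meanDiff_congr_ae h (Lp.coeFn_add a.1 b.1) n,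
    meanDiff_add_ae h (Lp.memLp a.1) (Lp.memLp b.1) n, Lp.coeFn_add (a.2 n) (b.2 n)]
    with x h1 h2 h3
  have h4 : (a + b).2 n = a.2 n + b.2 n := rfl
  simp only [fockDefect, Pi.add_apply, Prod.fst_add, h4, h1, h2, h3]
  ring

lemma fockDefect_smul (h : HasPoissonLaplace μ ν) (c : ℝ) (a : Lp ℝ 2 ν × FockSpace μ) (n : ℕ) :
    fockDefect (c • a) n =ᵐ[Measure.pi fun _ : Fin n => μ] c • fockDefect a n := by
  filter_upwards [meanDiff_congr_ae h (Lp.coeFn_smul c a.1) n, Lp.coeFn_smul c (a.2 n)]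
    with x h1 h3
  have h4 : (c • a).2 n = c • a.2 n := rfl
  simp only [fockDefect, Pi.smul_apply, Prod.smul_fst, h4, h1, h3, meanDiff_smul, smul_eq_mul]
  ring

lemma lintegral_enorm_le_of_Lp {α : Type*} [MeasurableSpace α] {m : Measure α} {s : Set α}
    (g : Lp ℝ 2 m) : ∫⁻ x in s, ‖g x‖ₑ ∂m ≤ ‖g‖ₑ * m s ^ (1 / 2 : ℝ) := by
  have h1 := eLpNorm_le_eLpNorm_mul_rpow_measure_univ (μ := m.restrict s) (p := 1) (q := 2)
    (by norm_num) (Lp.aestronglyMeasurable g).restrict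
  rw [eLpNorm_one_eq_lintegral_enorm] at h1
  refine h1.trans ?_
  rw [Lp.enorm_def, Measure.restrict_apply_univ]
  refine mul_le_mul' (eLpNorm_mono_measure _ Measure.restrict_le_self) (le_of_eq ?_)
  norm_num

lemma lintegral_fockDefect_le (h : HasPoissonLaplace μ ν) {B : Set X}
    (hB : MeasurableSet B) (hμB : μ B < ∞) (n : ℕ) :
    ∃ C : ℝ≥0∞, C < ∞ ∧ ∀ a : Lp ℝ 2 ν × FockSpace μ,
      ∫⁻ x in Set.univ.pi fun _ => B, ‖fockDefect a n x‖ₑ ∂(Measure.pi fun _ : Fin n => μ) ≤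
        C * ‖a‖ₑ := by
  have hfin : Measure.pi (fun _ : Fin n => μ) (Set.univ.pi fun _ => B) < ∞ := by
    rw [Measure.pi_pi]
    exact ENNReal.prod_lt_top fun _ _ => hμB
  refine ⟨diffBound μ ν B n + ‖√(n ! : ℝ)‖ₑ *
    Measure.pi (fun _ : Fin n => μ) (Set.univ.pi fun _ => B) ^ (1 / 2 : ℝ), ?_, fun a => ?_⟩
  · exact ENNReal.add_lt_top.2 ⟨diffBound_lt_top h hB hμB n, ENNReal.mul_lt_top enorm_lt_top
      (ENNReal.rpow_lt_top_of_nonneg (by norm_num) hfin.ne)⟩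
  · have hF : AEMeasurable (fun x => ‖√(n ! : ℝ)‖ₑ * ‖a.2 n x‖ₑ)
        ((Measure.pi fun _ : Fin n => μ).restrict (Set.univ.pi fun _ => B)) :=
      ((Lp.aestronglyMeasurable (a.2 n)).enorm.const_mul _).restrict
    have h1 : ‖a.1‖ₑ ≤ ‖a‖ₑ := enorm_le_iff_norm_le.2 (norm_fst_le a)
    have h2 : ‖a.2 n‖ₑ ≤ ‖a‖ₑ := enorm_le_iff_norm_le.2
      ((lp.norm_apply_le_norm (by norm_num) a.2 n).trans (norm_snd_le a))
    calc ∫⁻ x in Set.univ.pi fun _ => B, ‖fockDefect a n x‖ₑ ∂(Measure.pi fun _ : Fin n => μ)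
        ≤ ∫⁻ x in Set.univ.pi fun _ => B, (‖meanDiff ν a.1 n x‖ₑ +
            ‖√(n ! : ℝ)‖ₑ * ‖a.2 n x‖ₑ) ∂(Measure.pi fun _ : Fin n => μ) := by
          refine lintegral_mono fun x => ?_
          rw [← enorm_mul]
          exact enorm_sub_le
      _ = ∫⁻ x in Set.univ.pi fun _ => B, ‖meanDiff ν a.1 n x‖ₑ
            ∂(Measure.pi fun _ : Fin n => μ) + ‖√(n ! : ℝ)‖ₑ *
            ∫⁻ x in Set.univ.pi fun _ => B, ‖a.2 n x‖ₑ ∂(Measure.pi fun _ : Fin n => μ) := by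
          rw [lintegral_add_right' _ hF, lintegral_const_mul' _ _ enorm_ne_top]
      _ ≤ diffBound μ ν B n * ‖a‖ₑ + ‖√(n ! : ℝ)‖ₑ * (‖a‖ₑ *
            Measure.pi (fun _ : Fin n => μ) (Set.univ.pi fun _ => B) ^ (1 / 2 : ℝ)) := by
          refine add_le_add ((lintegral_meanDiff_le h hB hμB
            (Lp.aestronglyMeasurable a.1) n).trans ?_) ?_
          · rw [← Lp.enorm_def]
            exact mul_le_mul' le_rfl h1
          · exact mul_le_mul' le_rfl ((lintegral_enorm_le_of_Lp (a.2 n)).trans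
              (mul_le_mul' h2 le_rfl))
      _ = _ := by ring

/-- The pairs `(f, F)` such that `E D^n f` is `√n!` times the `n`-th component of `F`
for every `n`. -/
noncomputable def fockGraph (h : HasPoissonLaplace μ ν) :
    Submodule ℝ (Lp ℝ 2 ν × FockSpace μ) where
  carrier := {a | ∀ n, fockDefect a n =ᵐ[Measure.pi fun _ : Fin n => μ] 0}
  zero_mem' := fun n => by
    have := fockDefect_smul h 0 (0 : Lp ℝ 2 ν × FockSpace μ) n
    simpa using this
  add_mem' := fun {a b} ha hb n => by
    filter_upwards [fockDefect_add h a b n, ha n, hb n] with x h1 h2 h3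
    simp [h1, h2, h3]
  smul_mem' := fun c a ha n => by
    filter_upwards [fockDefect_smul h c a n, ha n] with x h1 h2
    simp [h1, h2]

lemma aestronglyMeasurable_fockDefect (h : HasPoissonLaplace μ ν) (a : Lp ℝ 2 ν × FockSpace μ)
    (n : ℕ) : AEStronglyMeasurable (fockDefect a n) (Measure.pi fun _ : Fin n => μ) :=
  (aestronglyMeasurable_meanDiff h (Lp.aestronglyMeasurable a.1) n).sub
    ((Lp.aestronglyMeasurable (a.2 n)).const_mul _)

/-- The defect is linear up to null sets and bounded into `L¹(B^n)` for `μ B < ∞`, so it vanishes in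
the limit on each `B^n`, and these exhaust the space. -/
lemma isClosed_fockGraph (h : HasPoissonLaplace μ ν) :
    IsClosed (fockGraph h : Set (Lp ℝ 2 ν × FockSpace μ)) := by
  refine isClosed_of_closure_subset fun a ha n => ?_
  refine ae_pi_of_ae_restrict_spanningSets fun k => ?_
  obtain ⟨C, hC, hle⟩ := lintegral_fockDefect_le h (measurableSet_spanningSets μ k)
    (measure_spanningSets_lt_top μ k) n
  have hzero : ∫⁻ x in Set.univ.pi fun _ => spanningSets μ k, ‖fockDefect a n x‖ₑ
      ∂(Measure.pi fun _ : Fin n => μ) = 0 := by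
    obtain ⟨b, hb, hlim⟩ := mem_closure_iff_seq_limit.1 ha
    have h1 : Filter.Tendsto (fun i => C * ‖a - b i‖ₑ) Filter.atTop (𝓝 0) := by
      have h2 : Filter.Tendsto (fun i => ‖a - b i‖ₑ) Filter.atTop (𝓝 ‖a - a‖ₑ) :=
        (tendsto_const_nhds.sub hlim).enorm
      have h3 := ENNReal.Tendsto.const_mul h2 (Or.inr hC.ne)
      simpa using h3
    refine le_antisymm (ge_of_tendsto' h1 fun i => ?_) zero_le
    -- As `b i` has zero defect, `a` and `a - b i` have the same defect almost everywhere.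
    refine le_trans (le_of_eq (lintegral_congr_ae (ae_restrict_of_ae ?_))) (hle (a - b i))
    have h4 := fockDefect_add h (a - b i) (b i) n
    rw [sub_add_cancel] at h4
    filter_upwards [h4, hb i n] with x h5 h6
    simp [h5, h6]
  have := (lintegral_eq_zero_iff'
    (aestronglyMeasurable_fockDefect h a n).restrict.enorm).1 hzero
  filter_upwards [this] with x hx
  simpa using hx

lemma lapPair_mem_fockGraph (h : HasPoissonLaplace μ ν)
    (u : {u : SimpleFunc X ℝ≥0 // μ (Function.support u) < ∞}) :
    lapPair ν u ∈ fockGraph h := by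
  intro n
  filter_upwards [meanDiff_congr_ae h (memLp_lap ν u.1).coeFn_toLp n,
    (memLp_lapCoeff u.2 n).coeFn_toLp] with x h1 h2
  simp only [fockDefect, lapPair, h1, meanDiff_lap h u.2, Pi.zero_apply]
  rw [← h2]
  exact sub_self _

/-- The chaos coefficients `(n!)^{-1/2} E D^n f` of a square integrable functional form an
element of the Fock space, in the closed graph generated by the exponential functionals. -/
theorem exists_fock (h : HasPoissonLaplace μ ν) {f : CountingMeasures X → ℝ}
    (hf : MemLp f 2 ν) : ∃ F : FockSpace μ, (hf.toLp f, F) ∈ closedGraph (lapPair (μ := μ) ν) ∧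
      ∀ n, meanDiff ν f n =ᵐ[Measure.pi fun _ : Fin n => μ] fun x => √(n ! : ℝ) * F n x := by
  obtain ⟨F, hF⟩ := exists_mem_closedGraph (inner_lapPair h)
    (fun e he => eq_zero_of_inner_lap μ e he) (hf.toLp f)
  refine ⟨F, hF, fun n => ?_⟩
  have hmem := closedGraph_le (isClosed_fockGraph h) (lapPair_mem_fockGraph h) hF
  filter_upwards [hmem n, meanDiff_congr_ae h hf.coeFn_toLp n] with x h1 h2
  simp only [fockDefect, Pi.zero_apply] at h1
  rw [← h2]
  linarith

lemma memLp_meanDiff (h : HasPoissonLaplace μ ν) {f : CountingMeasures X → ℝ}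
    (hf : MemLp f 2 ν) (n : ℕ) : MemLp (meanDiff ν f n) 2 (Measure.pi fun _ : Fin n => μ) := by
  obtain ⟨F, -, hF⟩ := exists_fock h hf
  exact ((Lp.memLp (F n)).const_mul _).ae_eq (hF n).symm

/-- The Fock space representation of Poisson functionals. -/
theorem hasSum_meanDiff (h : HasPoissonLaplace μ ν) {f g : CountingMeasures X → ℝ}
    (hf : MemLp f 2 ν) (hg : MemLp g 2 ν) :
    HasSum (fun n : ℕ => 1 / (n ! : ℝ) * ∫ x, meanDiff ν f n x * meanDiff ν g n x
      ∂(Measure.pi fun _ : Fin n => μ)) (∫ χ, f χ * g χ ∂ν) := by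
  obtain ⟨F, hFV, hF⟩ := exists_fock h hf
  obtain ⟨G, hGV, hG⟩ := exists_fock h hg
  have h1 := inner_eq_of_mem_closedGraph (inner_lapPair h) hFV hGV
  simp only [inner_toLp] at h1
  rw [h1]
  refine (lp.hasSum_inner (𝕜 := ℝ) F G).congr_fun fun n => ?_
  rw [L2.inner_def, ← integral_const_mul]
  refine integral_congr_ae ?_
  filter_upwards [hF n, hG n] with x h2 h3
  simp only [h2, h3, RCLike.inner_apply, conj_trivial]
  have h4 : √(n ! : ℝ) * √(n ! : ℝ) = n ! := Real.mul_self_sqrt (Nat.cast_nonneg _)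
  have h5 : (n ! : ℝ) ≠ 0 := by positivity
  calc 1 / (n ! : ℝ) * (√(n ! : ℝ) * F n x * (√(n ! : ℝ) * G n x))
      = 1 / (n ! : ℝ) * (√(n ! : ℝ) * √(n ! : ℝ)) * (G n x * F n x) := by ring
    _ = G n x * F n x := by
      rw [h4, one_div, inv_mul_cancel₀ h5, one_mul]

end CountingMeasures

/-! ### Transfer to the underlying probability space. -/

section

variable {Ω X : Type*} [MeasurableSpace Ω] [MeasurableSpace X] {P : Measure Ω}
  [IsProbabilityMeasure P] {μ : Measure X} {η : Ω → CountingMeasures X}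

open CountingMeasures

lemma IsPoissonProcess.hasPoissonLaplace (hη : IsPoissonProcess η μ P) :
    HasPoissonLaplace μ (P.map η) :=
  fun u hu => hη.integral_lap u hu

lemma IsPoissonProcess.ae_integrable [SigmaFinite μ] (hη : IsPoissonProcess η μ P)
    {f : CountingMeasures X → ℝ} (hf : MemLp f 2 (P.map η)) (n : ℕ) :
    ∀ᵐ x ∂(Measure.pi fun _ : Fin n => μ),
      Integrable (fun ω => iterDiffOp f n x (η ω)) P ∧
        expectedDiff η P f n x = meanDiff (P.map η) f n x := by
  have := Measure.isProbabilityMeasure_map (μ := P) hη.measurable.aemeasurable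
  filter_upwards [ae_integrable_iterDiffOp hη.hasPoissonLaplace hf n] with x hx
  exact ⟨hx.comp_measurable hη.measurable,
    (integral_map hη.measurable.aemeasurable hx.1).symm⟩

end

theorem theorem1 {Ω X : Type*} [MeasurableSpace Ω] [MeasurableSpace X]
    (P : Measure Ω) [IsProbabilityMeasure P] (μ : Measure X) [SigmaFinite μ]
    (η : Ω → CountingMeasures X) (hη : IsPoissonProcess η μ P)
    (f g : CountingMeasures X → ℝ)
    (hf : MemLp f 2 (P.map η)) (hg : MemLp g 2 (P.map η)) :
    -- the expectations defining `T_n f` exist almost everywhere, and `T_n f` is in `L²(μ^n)`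
    (∀ n : ℕ,
      (∀ᵐ x ∂(Measure.pi fun _ : Fin n => μ),
        Integrable (fun ω => CountingMeasures.iterDiffOp f n x (η ω)) P) ∧
      MemLp (expectedDiff η P f n) 2 (Measure.pi fun _ : Fin n => μ)) ∧
    -- the same for `g`
    (∀ n : ℕ,
      (∀ᵐ x ∂(Measure.pi fun _ : Fin n => μ),
        Integrable (fun ω => CountingMeasures.iterDiffOp g n x (η ω)) P) ∧
      MemLp (expectedDiff η P g n) 2 (Measure.pi fun _ : Fin n => μ)) ∧
    -- the series over `n + 1 ≥ 1` converges absolutely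
    Summable (fun n : ℕ =>
      |1 / ((n + 1)! : ℝ) * ∫ x, expectedDiff η P f (n + 1) x * expectedDiff η P g (n + 1) x
        ∂(Measure.pi fun _ : Fin (n + 1) => μ)|) ∧
    -- the covariance identity
    ∫ ω, f (η ω) * g (η ω) ∂P =
      (∫ ω, f (η ω) ∂P) * (∫ ω, g (η ω) ∂P) +
        ∑' n : ℕ, 1 / ((n + 1)! : ℝ) *
          ∫ x, expectedDiff η P f (n + 1) x * expectedDiff η P g (n + 1) x
            ∂(Measure.pi fun _ : Fin (n + 1) => μ) := by
  have hprob := Measure.isProbabilityMeasure_map (μ := P) hη.measurable.aemeasurable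
  have h := hη.hasPoissonLaplace
  have hpart : ∀ {f : CountingMeasures X → ℝ}, MemLp f 2 (P.map η) → ∀ n : ℕ,
      (∀ᵐ x ∂(Measure.pi fun _ : Fin n => μ),
        Integrable (fun ω => CountingMeasures.iterDiffOp f n x (η ω)) P) ∧
      MemLp (expectedDiff η P f n) 2 (Measure.pi fun _ : Fin n => μ) := fun hf n =>
    ⟨(hη.ae_integrable hf n).mono fun x hx => hx.1,
      (CountingMeasures.memLp_meanDiff h hf n).ae_eq
        ((hη.ae_integrable hf n).mono fun x hx => hx.2.symm)⟩
  have hsum := CountingMeasures.hasSum_meanDiff h hf hg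
  have hint : ∀ n : ℕ, ∫ x, CountingMeasures.meanDiff (P.map η) f n x *
      CountingMeasures.meanDiff (P.map η) g n x ∂(Measure.pi fun _ : Fin n => μ) =
      ∫ x, expectedDiff η P f n x * expectedDiff η P g n x
        ∂(Measure.pi fun _ : Fin n => μ) := by
    intro n
    refine integral_congr_ae ?_
    filter_upwards [hη.ae_integrable hf n, hη.ae_integrable hg n] with x h1 h2
    rw [h1.2, h2.2]
  simp only [hint] at hsum
  rw [integral_map (f := fun χ => f χ * g χ) hη.measurable.aemeasurable
    (hf.1.mul hg.1)] at hsum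
  refine ⟨hpart hf, hpart hg, ((summable_nat_add_iff 1).2 hsum.summable).abs, ?_⟩
  -- The measure `μ^0` is a unit point mass and `D^0` is the identity.
  have h0 : ∫ x, expectedDiff η P f 0 x * expectedDiff η P g 0 x
      ∂(Measure.pi fun _ : Fin 0 => μ) = (∫ ω, f (η ω) ∂P) * (∫ ω, g (η ω) ∂P) := by
    rw [Measure.pi_of_empty, integral_dirac]
    rfl
  rw [← hsum.tsum_eq, hsum.summable.tsum_eq_zero_add, h0]
  simp
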